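/- Let $X$ be a complex Banach space and $1\le p\le\infty$, with conjugate exponent $p^*$ ($1/p+1/p^*=1$, $1/\infty:=0$). Let $\mathbb T^{\mathbb N}$ be the infinite-dimensional torus with its normalized Haar measure $d\omega$, let $\mathbb Z^{(\mathbb N)}$ and $\mathbb N_0^{(\mathbb N)}$ be the finitely supported sequences in $\mathbb Z$ and in $\mathbb N_0=\{0,1,2,\dots\}$, let $\mathfrak p=(\mathfrak p_1<\mathfrak p_2<\cdots)$ be the sequence of primes, and write $\omega^\alpha=\prod_j\omega_j^{\alpha_j}$, $\mathfrak p^\alpha=\prod_j\mathfrak p_j^{\alpha_j}$. The Bohr transform $\mathcal B$ sends a formal power series $\sum_{\alpha\in\mathbb N_0^{(\mathbb N)}}c_\alpha z^\alpha$ with coefficients in $X$ to the Dirichlet series $\sum_{n\ge1}a_nn^{-s}$ with $a_{\mathfrak p^\alpha}=c_\alpha$. Hardy spaces. $H_p(\mathbb T^{\mathbb N},X)$ is the subspace of those $f\in L_p(\mathbb T^{\mathbb N},X)$ with $\hat f(\alpha)=\int f(\omega)\,\omega^{-\alpha}\,d\omega=0$ for all $\alpha\in\mathbb Z^{(\mathbb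 N)}\setminus\mathbb N_0^{(\mathbb N)}$; $\mathcal H_p(X)$ is its image under $f\mapsto\mathcal B\big(\sum_{\alpha\in\mathbb N_0^{(\mathbb N)}}\hat f(\alpha)z^\alpha\big)$ with the transported norm. $\mathcal H_p^+(X)$ is the space of all Dirichlet series $D=\sum_n a_nn^{-s}$ in $X$ such that $D_\varepsilon=\sum_n\frac{a_n}{n^\varepsilon}n^{-s}\in\mathcal H_p(X)$ for every $\varepsilon>0$ and $\|D\|_{\mathcal H_p^+(X)}:=\sup_{\varepsilon>0}\|D_\varepsilon\|_{\mathcal H_p(X)}<\infty$. Operators. Let $E_{p^*}(\mathbb T^{\mathbb N})$ be $L_{p^*}(\mathbb T^{\mathbb N})$ if $p>1$, and $C(\mathbb T^{\mathbb N})$ if $p=1$ (complex-valued functions). A bounded linear operator $T:E\to X$ on a Banach lattice $E$ is cone absolutely summing if there is $C>0$ with $\sum_{i=1}^n\|Tf_i\|\le C\,\sup_{\xi\in B_{E^*}}\sum_{i=1}^n|\xi(f_i)|$ for all finite families of positive elements $f_1,\dots,f_n\in E$; $\|T\|_\Lambda$ is the infimum of such $C$. Let $\Lambda^+(E_{p^*}(\mathbb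 T^{\mathbb N}),X)$ be the space of all cone absolutely summing $T:E_{p^*}(\mathbb T^{\mathbb N})\to X$ with $T(\omega^{-\alpha})=0$ for every $\alpha\in\mathbb Z^{(\mathbb N)}\setminus\mathbb N_0^{(\mathbb N)}$, with the norm $\|\cdot\|_\Lambda$. Theorem. The Bohr transform $$T\ \longmapsto\ \mathcal B\Big(\sum_{\alpha\in\mathbb N_0^{(\mathbb N)}}T(\omega^{-\alpha})z^\alpha\Big)=\sum_{n\ge1}a_nn^{-s},\qquad a_n=T(\omega^{-\alpha})\ \text{ for } n=\mathfrak p^\alpha,$$ defines a linear bijection from $\Lambda^+(E_{p^*}(\mathbb T^{\mathbb N}),X)$ onto $\mathcal H_p^+(X)$, and it is isometric: the image $D$ of $T$ satisfies $\|D\|_{\mathcal H_p^+(X)}=\|T\|_\Lambda$. -/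

import Mathlib

open MeasureTheory
open scoped ENNReal ComplexOrder

/-! ## The infinite-dimensional torus and its characters -/

noncomputable section

instance Circle.instMeasurableSpaceBorel : MeasurableSpace Circle := borel Circle

instance Circle.instBorelSpaceBorel : BorelSpace Circle := ⟨rfl⟩

/-- The infinite-dimensional torus `𝕋^ℕ`, with the product topology, the pointwise group structure
and the product (equivalently, Borel) σ-algebra. -/
abbrev InfTorus : Type := ℕ → Circle

/-- The Haar measure of `𝕋^ℕ`, normalized to have total mass one. -/
def torusHaar : Measure InfTorus := Measure.haarMeasure ⊤

instance torusHaar_isProbabilityMeasure : IsProbabilityMeasure torusHaar :=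
  ⟨Measure.haarMeasure_self⟩

/-- The character `ω ↦ ω^α` of `𝕋^ℕ` for a finitely supported sequence `α` of integers. -/
def torusMonomial (α : ℕ →₀ ℤ) : C(InfTorus, ℂ) where
  toFun ω := ((∏ j ∈ α.support, ω j ^ α j : Circle) : ℂ)
  continuous_toFun := by fun_prop

/-- A finitely supported sequence of natural numbers, seen as a sequence of integers. -/
def natIndex (α : ℕ →₀ ℕ) : ℕ →₀ ℤ := α.mapRange (fun k : ℕ => (k : ℤ)) Nat.cast_zero

/-! ## Formal power series, Dirichlet series and the Bohr transform -/

/-- Formal Dirichlet series `∑ a_n n^{-s}` with coefficients in `X`. -/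
abbrev DirichletSeries (X : Type*) : Type _ := ℕ+ → X

/-- Formal power series `∑ c_α z^α` in infinitely many variables with coefficients in `X`. -/
abbrev FormalSeries (X : Type*) : Type _ := (ℕ →₀ ℕ) → X

/-- The exponent sequence of the prime number decomposition of `n`; the `j`-th prime is
`Nat.nth Nat.Prime j`, starting with `2` at `j = 0`. -/
def primeExponents (n : ℕ+) : ℕ →₀ ℕ :=
  (n : ℕ).factorization.comapDomain (Nat.nth Nat.Prime)
    (Nat.nth_injective Nat.infinite_setOfPred_prime).injOn

/-- The natural number `𝔭^α = 𝔭₁^α₁ 𝔭₂^α₂ ⋯`. -/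
def primePow (α : ℕ →₀ ℕ) : ℕ+ :=
  ⟨α.prod fun j k => Nat.nth Nat.Prime j ^ k,
    Finset.prod_pos fun j _ => pow_pos (Nat.prime_nth_prime j).pos _⟩

lemma primeExponents_primePow (α : ℕ →₀ ℕ) : primeExponents (primePow α) = α := by
  have hinj := Nat.nth_injective Nat.infinite_setOfPred_prime
  have h1 : (primePow α : ℕ) = (α.embDomain ⟨Nat.nth Nat.Prime, hinj⟩).prod (· ^ ·) := by
    rw [Finsupp.prod_embDomain]; rfl
  have h2 : (primePow α : ℕ).factorization = α.embDomain ⟨Nat.nth Nat.Prime, hinj⟩ := by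
    rw [h1]
    apply Nat.prod_pow_factorization_eq_self
    intro p hp
    rw [Finsupp.support_embDomain, Finset.mem_map] at hp
    obtain ⟨j, -, rfl⟩ := hp
    exact Nat.prime_nth_prime j
  ext j
  simp only [primeExponents, Finsupp.comapDomain_apply, h2]
  exact Finsupp.embDomain_apply_self ⟨Nat.nth Nat.Prime, hinj⟩ α j

lemma primeExponents_injective : Function.Injective primeExponents := by
  intro m n h
  apply PNat.coe_injective
  apply Nat.eq_of_factorization_eq m.ne_zero n.ne_zero
  intro p
  by_cases hp : p.Prime
  · have h1 := DFunLike.congr_fun h (Nat.count Nat.Prime p)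
    simpa [primeExponents, Finsupp.comapDomain_apply, Nat.nth_count hp] using h1
  · rw [Nat.factorization_eq_zero_of_not_prime _ hp, Nat.factorization_eq_zero_of_not_prime _ hp]

/-- The bijection `α ↦ 𝔭^α` between exponent sequences and positive integers. -/
def primePowEquiv : (ℕ →₀ ℕ) ≃ ℕ+ where
  toFun := primePow
  invFun := primeExponents
  left_inv := primeExponents_primePow
  right_inv _ := primeExponents_injective (primeExponents_primePow _)

variable {X : Type*} [NormedAddCommGroup X] [NormedSpace ℂ X]

/-- The Bohr transform: `∑ c_α z^α ↦ ∑ a_n n^{-s}` with `a_n = c_α` whenever `n = 𝔭^α`. -/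
def bohrTransform : FormalSeries X ≃ₗ[ℂ] DirichletSeries X :=
  LinearEquiv.funCongrLeft ℂ X primePowEquiv.symm

lemma bohrTransform_primePow (c : FormalSeries X) (α : ℕ →₀ ℕ) :
    bohrTransform c (primePow α) = c α := by
  change c (primePowEquiv.symm (primePowEquiv α)) = c α
  rw [Equiv.symm_apply_apply]

/-- The translation `D_z = ∑ (a_n / n^z) n^{-s}` of a Dirichlet series. -/
def dirichletTranslate (z : ℂ) : DirichletSeries X →ₗ[ℂ] DirichletSeries X where
  toFun a n := (((n : ℕ) : ℂ) ^ z)⁻¹ • a n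
  map_add' a b := by ext n; simp
  map_smul' c a := by ext n; simp [smul_comm c]

/-! ## Hardy spaces -/

lemma integrable_monomial_smul (p : ℝ≥0∞) [Fact (1 ≤ p)] (f : Lp X p torusHaar) (α : ℕ →₀ ℤ) :
    Integrable (fun ω => torusMonomial α ω • f ω) torusHaar := by
  have hf : Integrable f torusHaar := (Lp.memLp f).integrable Fact.out
  refine hf.bdd_smul 1 (torusMonomial α).continuous.aestronglyMeasurable ?_
  exact Filter.Eventually.of_forall fun _ => (Circle.norm_coe _).le

/-- The Fourier coefficient `f̂(α) = ∫ f(ω) ω^{-α} dω` of `f ∈ L_p(𝕋^ℕ, X)`. -/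
def torusFourierCoeff (p : ℝ≥0∞) [Fact (1 ≤ p)] (α : ℕ →₀ ℤ) : Lp X p torusHaar →ₗ[ℂ] X where
  toFun f := ∫ ω, torusMonomial (-α) ω • f ω ∂torusHaar
  map_add' f g := by
    rw [← integral_add (integrable_monomial_smul p f _) (integrable_monomial_smul p g _)]
    refine integral_congr_ae ?_
    filter_upwards [Lp.coeFn_add f g] with ω h
    rw [h, Pi.add_apply, smul_add]
  map_smul' c f := by
    rw [RingHom.id_apply, ← integral_smul]
    refine integral_congr_ae ?_
    filter_upwards [Lp.coeFn_smul c f] with ω h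
    rw [h, Pi.smul_apply, smul_comm]

variable (X) in
/-- `H_p(𝕋^ℕ, X)`: the functions in `L_p(𝕋^ℕ, X)` all of whose Fourier coefficients at indices
with some negative entry vanish. -/
def hardyTorus (p : ℝ≥0∞) [Fact (1 ≤ p)] : Submodule ℂ (Lp X p torusHaar) where
  carrier := {f | ∀ α : ℕ →₀ ℤ, (∃ j, α j < 0) → torusFourierCoeff p α f = 0}
  add_mem' hf hg α hα := by rw [map_add, hf α hα, hg α hα, add_zero]
  zero_mem' α _ := map_zero _
  smul_mem' c f hf α hα := by rw [map_smul, hf α hα, smul_zero]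

/-- The Dirichlet series with coefficients `a_n = f̂(α)`, `n = 𝔭^α`, `α ∈ ℕ₀^(ℕ)`. -/
def torusToDirichlet (p : ℝ≥0∞) [Fact (1 ≤ p)] : Lp X p torusHaar →ₗ[ℂ] DirichletSeries X :=
  bohrTransform.toLinearMap ∘ₗ LinearMap.pi fun α : ℕ →₀ ℕ => torusFourierCoeff p (natIndex α)

variable (X) in
/-- `ℋ_p(X)`: the image of `H_p(𝕋^ℕ, X)` under the Bohr transform. -/
def hardyDirichlet (p : ℝ≥0∞) [Fact (1 ≤ p)] : Submodule ℂ (DirichletSeries X) :=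
  (hardyTorus X p).map (torusToDirichlet p)

/-- The norm of `ℋ_p(X)`, transported from `H_p(𝕋^ℕ, X)`. (By uniqueness of Fourier coefficients,
`f` below is uniquely determined by `D`, so that the infimum is over a single number.) -/
def hardyNorm (p : ℝ≥0∞) [Fact (1 ≤ p)] (D : DirichletSeries X) : ℝ :=
  sInf {r : ℝ | ∃ f ∈ hardyTorus X p, torusToDirichlet p f = D ∧ ‖f‖ = r}

lemma hardyNorm_le {p : ℝ≥0∞} [Fact (1 ≤ p)] {f : Lp X p torusHaar} (hf : f ∈ hardyTorus X p) :
    hardyNorm p (torusToDirichlet p f) ≤ ‖f‖ :=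
  csInf_le ⟨0, by rintro r ⟨g, -, -, rfl⟩; exact norm_nonneg g⟩ ⟨f, hf, rfl, rfl⟩

lemma exists_norm_lt_of_hardyNorm_lt {p : ℝ≥0∞} [Fact (1 ≤ p)] {D : DirichletSeries X}
    (hD : D ∈ hardyDirichlet X p) {r : ℝ} (hr : hardyNorm p D < r) :
    ∃ f ∈ hardyTorus X p, torusToDirichlet p f = D ∧ ‖f‖ < r := by
  obtain ⟨f, hf, hfD⟩ := hD
  obtain ⟨s, ⟨g, hg, hgD, rfl⟩, hs⟩ :=
    exists_lt_of_csInf_lt (s := {r : ℝ | ∃ f ∈ hardyTorus X p, torusToDirichlet p f = D ∧ ‖f‖ = r})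
      ⟨‖f‖, f, hf, hfD, rfl⟩ hr
  exact ⟨g, hg, hgD, hs⟩

lemma hardyNorm_add_le {p : ℝ≥0∞} [Fact (1 ≤ p)] {D D' : DirichletSeries X}
    (hD : D ∈ hardyDirichlet X p) (hD' : D' ∈ hardyDirichlet X p) :
    hardyNorm p (D + D') ≤ hardyNorm p D + hardyNorm p D' := by
  refine le_of_forall_pos_le_add fun δ hδ => ?_
  obtain ⟨f, hf, rfl, h1⟩ :=
    exists_norm_lt_of_hardyNorm_lt hD (lt_add_of_pos_right _ (half_pos hδ))
  obtain ⟨g, hg, rfl, h2⟩ :=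
    exists_norm_lt_of_hardyNorm_lt hD' (lt_add_of_pos_right _ (half_pos hδ))
  have h3 := hardyNorm_le ((hardyTorus X p).add_mem hf hg)
  rw [map_add] at h3
  have h4 := norm_add_le f g
  linarith

lemma hardyNorm_smul_le {p : ℝ≥0∞} [Fact (1 ≤ p)] {D : DirichletSeries X}
    (hD : D ∈ hardyDirichlet X p) (c : ℂ) {M : ℝ} (hM : hardyNorm p D ≤ M) :
    hardyNorm p (c • D) ≤ ‖c‖ * (M + 1) := by
  obtain ⟨f, hf, rfl, h1⟩ := exists_norm_lt_of_hardyNorm_lt hD (hM.trans_lt (lt_add_one M))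
  have h3 := hardyNorm_le ((hardyTorus X p).smul_mem c hf)
  rw [map_smul, norm_smul] at h3
  exact h3.trans (mul_le_mul_of_nonneg_left h1.le (norm_nonneg c))

variable (X) in
/-- `ℋ_p⁺(X)`: the Dirichlet series `D` with `D_ε ∈ ℋ_p(X)` for all `ε > 0` and
`sup_{ε > 0} ‖D_ε‖ < ∞`. -/
def hardyPlus (p : ℝ≥0∞) [Fact (1 ≤ p)] : Submodule ℂ (DirichletSeries X) where
  carrier := {D | (∀ ε : ℝ, 0 < ε → dirichletTranslate (ε : ℂ) D ∈ hardyDirichlet X p) ∧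
    ∃ M : ℝ, ∀ ε : ℝ, 0 < ε → hardyNorm p (dirichletTranslate (ε : ℂ) D) ≤ M}
  add_mem' := by
    rintro D D' ⟨h1, M, hM⟩ ⟨h1', M', hM'⟩
    refine ⟨fun ε hε => ?_, M + M', fun ε hε => ?_⟩
    · rw [map_add]; exact Submodule.add_mem _ (h1 ε hε) (h1' ε hε)
    · rw [map_add]
      exact (hardyNorm_add_le (h1 ε hε) (h1' ε hε)).trans (add_le_add (hM ε hε) (hM' ε hε))
  zero_mem' := by
    refine ⟨fun ε _ => ?_, 0, fun ε _ => ?_⟩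
    · rw [map_zero]; exact Submodule.zero_mem _
    · have := hardyNorm_le (hardyTorus X p).zero_mem
      rw [map_zero, norm_zero] at this
      rwa [map_zero]
  smul_mem' := by
    rintro c D ⟨h1, M, hM⟩
    refine ⟨fun ε hε => ?_, ‖c‖ * (M + 1), fun ε hε => ?_⟩
    · rw [map_smul]; exact Submodule.smul_mem _ c (h1 ε hε)
    · rw [map_smul]; exact hardyNorm_smul_le (h1 ε hε) c (hM ε hε)

/-- The norm `sup_{ε > 0} ‖D_ε‖` of `ℋ_p⁺(X)`. -/
def hardyPlusNorm (p : ℝ≥0∞) [Fact (1 ≤ p)] (D : DirichletSeries X) : ℝ :=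
  ⨆ ε : {ε : ℝ // 0 < ε}, hardyNorm p (dirichletTranslate ((ε : ℝ) : ℂ) D)

/-! ## Cone absolutely summing operators -/

section Cone

variable {E : Type*} [NormedAddCommGroup E] [NormedSpace ℂ E] [PartialOrder E]

/-- The defining inequality of cone absolutely summing operators on a (complex) Banach lattice `E`,
with constant `C`: for finitely many positive elements `f_i` of `E`, the sum `∑ ‖T f_i‖` is at most
`C` times the supremum of `∑ |ξ f_i|` over the closed unit ball of the dual of `E`. -/
def ConeSummingWith (C : ℝ) (T : E →L[ℂ] X) : Prop :=
  ∀ (n : ℕ) (f : Fin n → E), (∀ i, 0 ≤ f i) →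
    ∑ i, ‖T (f i)‖ ≤ C * ⨆ ξ : Metric.closedBall (0 : StrongDual ℂ E) 1, ∑ i, ‖ξ.1 (f i)‖

variable (X E) in
/-- `Λ(E, X)`: the space of cone absolutely summing operators. -/
def coneSumming : Submodule ℂ (E →L[ℂ] X) where
  carrier := {T | ∃ C : ℝ, 0 < C ∧ ConeSummingWith C T}
  add_mem' := by
    rintro S T ⟨C, hC, hS⟩ ⟨C', hC', hT⟩
    refine ⟨C + C', add_pos hC hC', fun n f hf => ?_⟩
    rw [add_mul]
    refine le_trans ?_ (add_le_add (hS n f hf) (hT n f hf))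
    rw [← Finset.sum_add_distrib]
    exact Finset.sum_le_sum fun i _ => norm_add_le _ _
  zero_mem' := by
    refine ⟨1, one_pos, fun n f _ => ?_⟩
    simpa using Real.iSup_nonneg
      fun ξ : Metric.closedBall (0 : StrongDual ℂ E) 1 =>
        Finset.sum_nonneg fun i _ => norm_nonneg (ξ.1 (f i))
  smul_mem' := by
    rintro c T ⟨C, hC, hT⟩
    refine ⟨(‖c‖ + 1) * C, by positivity, fun n f hf => ?_⟩
    have h0 : 0 ≤ ∑ i, ‖T (f i)‖ := Finset.sum_nonneg fun i _ => norm_nonneg _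
    calc ∑ i, ‖(c • T) (f i)‖ = ‖c‖ * ∑ i, ‖T (f i)‖ := by
          simp [Finset.mul_sum, norm_smul]
      _ ≤ (‖c‖ + 1) * ∑ i, ‖T (f i)‖ := by nlinarith
      _ ≤ _ := by
          rw [mul_assoc]
          exact mul_le_mul_of_nonneg_left (hT n f hf) (by positivity)

/-- The norm of `Λ(E, X)`: the infimum of all admissible constants. -/
def coneNorm (T : E →L[ℂ] X) : ℝ := sInf {C : ℝ | 0 < C ∧ ConeSummingWith C T}

variable (X) in
/-- `Λ⁺(E, X)`, where `χ α` is the character `ω^α` as an element of the function space `E`: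
the cone absolutely summing operators `T` with `T(ω^{-α}) = 0` for every `α ∈ ℤ^(ℕ)` having a
negative entry. -/
def lambdaPlus (χ : (ℕ →₀ ℤ) → E) : Submodule ℂ (E →L[ℂ] X) where
  carrier := {T | T ∈ coneSumming X E ∧ ∀ α : ℕ →₀ ℤ, (∃ j, α j < 0) → T (χ (-α)) = 0}
  add_mem' hS hT := ⟨Submodule.add_mem _ hS.1 hT.1, fun α hα => by
    rw [add_apply, hS.2 α hα, hT.2 α hα, add_zero]⟩
  zero_mem' := ⟨Submodule.zero_mem _, fun _ _ => rfl⟩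
  smul_mem' c T hT := ⟨Submodule.smul_mem _ c hT.1, fun α hα => by
    rw [smul_apply, hT.2 α hα, smul_zero]⟩

/-- The Fourier series `∑ T(ω^{-α}) z^α`, `α ∈ ℕ₀^(ℕ)`, of an operator `T`. -/
def operatorSeries (χ : (ℕ →₀ ℤ) → E) (T : E →L[ℂ] X) : FormalSeries X :=
  fun α => T (χ (-natIndex α))

end Cone

/-- The character `ω^α` as an element of `L_q(𝕋^ℕ)`. -/
def lpMonomial (q : ℝ≥0∞) [Fact (1 ≤ q)] (α : ℕ →₀ ℤ) : Lp ℂ q torusHaar :=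
  ContinuousMap.toLp q torusHaar ℂ (torusMonomial α)

end

section HardySpaces

variable {X : Type*} [NormedAddCommGroup X] [NormedSpace ℂ X]

/-! ## Characters of the torus -/

section Characters

open Filter Topology

/-! A function `f` in `L_p` acts on functions by `g ↦ ∫ g f`, and the summing norm mirrors the `L_p`
norm because, for positive `g_i`, the supremum in its definition is `‖∑ g_i‖`. For a general Banach
space `X` an operator need not have such a density `f`; the translations `D_ε` regularize it enough
to have one.

From `T` to `D`: the `N`-th Fejér mean `P_N` of `T` at `ω` is `T` applied to a translated Fejér
kernel. Integrating the summing inequality against `h ≥ 0` (`integral_norm_le_of_summing`) gives `∫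
h ‖P_N‖ ≤ C ‖h‖`, and duality gives `‖P_N‖ ≤ C` in `L_p`. The `P_N` may fail to converge, but they
do once the coefficients are damped by `exp (-ε log 𝔭^α)`. This multiplier is a mixture over `R` of
the triangles `(1 - log 𝔭^α / R)₊` (`integral_mixDensity_mul_triangle`). Each triangle is a
contraction of `L_p`, being an average of translations along the flow `𝔭^{it}` against a Fejér
kernel of the line (`norm_sum_triangle_smul_monomialLp_le`), and it keeps only the finitely many `α`
with `𝔭^α < e^R`. So radii below a cut converge coefficientwise, while the rest is uniformly small
(`exists_tendsto_sum_exp_smul`). The limit lies in `H_p`, has norm at most `C` and represents `D_ε`.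

From `D` to `T`: functions representing `D_ε`, with `ε → 0`, pair with `E` to give uniformly bounded
operators that converge on characters, hence everywhere by density. Hölder's inequality bounds their
summing constants, and the bound survives the limit (`TorusDuality.exists_operator`).

Operators are determined by their values on characters, so the two constructions are inverse to each
other, and comparing constants gives the isometry. `TorusDuality` gathers what is needed of `E`, so
that `L_q` and `C(𝕋^ℕ)` share one argument. -/

lemma torusMonomial_apply (α : ℕ →₀ ℤ) (ω : InfTorus) :
    torusMonomial α ω = ((α.prod fun j k => ω j ^ k : Circle) : ℂ) := rfl

lemma torusMonomial_zero_apply (ω : InfTorus) : torusMonomial 0 ω = 1 := by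
  simp [torusMonomial_apply]

lemma torusMonomial_add_apply (α β : ℕ →₀ ℤ) (ω : InfTorus) :
    torusMonomial (α + β) ω = torusMonomial α ω * torusMonomial β ω := by
  simp only [torusMonomial_apply]
  rw [Finsupp.prod_add_index' (fun _ => zpow_zero _) (fun _ _ _ => zpow_add _ _ _), Circle.coe_mul]

lemma torusMonomial_apply_mul (α : ℕ →₀ ℤ) (ω u : InfTorus) :
    torusMonomial α (ω * u) = torusMonomial α ω * torusMonomial α u := by
  simp only [torusMonomial_apply]
  rw [← Circle.coe_mul, ← Finsupp.prod_mul]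
  simp only [Pi.mul_apply, mul_zpow]

lemma norm_torusMonomial_apply (α : ℕ →₀ ℤ) (ω : InfTorus) : ‖torusMonomial α ω‖ = 1 :=
  Circle.norm_coe _

lemma torusMonomial_neg_apply (α : ℕ →₀ ℤ) (ω : InfTorus) :
    torusMonomial (-α) ω = starRingEnd ℂ (torusMonomial α ω) := by
  have h1 : torusMonomial (-α) ω * torusMonomial α ω = 1 := by
    rw [← torusMonomial_add_apply, neg_add_cancel, torusMonomial_zero_apply]
  have h2 : starRingEnd ℂ (torusMonomial α ω) * torusMonomial α ω = 1 := by
    rw [Complex.conj_mul', norm_torusMonomial_apply]; simp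
  have h3 : torusMonomial α ω ≠ 0 := by
    rw [← norm_ne_zero_iff, norm_torusMonomial_apply]; exact one_ne_zero
  exact mul_right_cancel₀ h3 (h1.trans h2.symm)

lemma torusMonomial_sub_apply (α β : ℕ →₀ ℤ) (ω : InfTorus) :
    torusMonomial (α - β) ω = torusMonomial α ω * starRingEnd ℂ (torusMonomial β ω) := by
  rw [sub_eq_add_neg, torusMonomial_add_apply, torusMonomial_neg_apply]

lemma torusMonomial_apply_inv (α : ℕ →₀ ℤ) (ω : InfTorus) :
    torusMonomial α ω⁻¹ = torusMonomial (-α) ω := by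
  simp only [torusMonomial_apply, Finsupp.prod, Finsupp.support_neg, Finsupp.coe_neg,
    Pi.neg_apply, zpow_neg, Pi.inv_apply, inv_zpow]

instance torusHaar_isHaarMeasure : torusHaar.IsHaarMeasure := by
  unfold torusHaar; infer_instance

lemma exists_torusMonomial_ne_one {α : ℕ →₀ ℤ} (hα : α ≠ 0) : ∃ u, torusMonomial α u ≠ 1 := by
  obtain ⟨j, hj⟩ := Finsupp.ne_iff.1 hα
  rw [Finsupp.coe_zero, Pi.zero_apply] at hj
  -- Only coordinate `j` differs from 1, and there the character takes the value `exp (iπ) = -1`.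
  refine ⟨Pi.mulSingle j (Circle.exp (Real.pi / α j)), ?_⟩
  rw [torusMonomial_apply, Finsupp.prod, Finset.prod_eq_single j]
  · rw [Pi.mulSingle_eq_same, ← Circle.exp_zsmul, Circle.coe_exp]
    have : ((α j • (Real.pi / (α j : ℝ)) : ℝ) : ℂ) = Real.pi := by
      have h : (α j : ℂ) ≠ 0 := by exact_mod_cast hj
      push_cast [zsmul_eq_mul]
      field_simp
    rw [this, Complex.exp_pi_mul_I]
    norm_num
  · intro i _ hij
    rw [Pi.mulSingle_eq_of_ne hij, one_zpow]
  · intro h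
    simp [Finsupp.notMem_support_iff.1 h]

/-- Translating by `u` multiplies the integral by `u^α` without changing it, so it vanishes as soon
as some `u^α` differs from 1. -/
lemma integral_torusMonomial (α : ℕ →₀ ℤ) :
    ∫ ω, torusMonomial α ω ∂torusHaar = if α = 0 then 1 else 0 := by
  split_ifs with h
  · subst h; simp [torusMonomial_zero_apply]
  · obtain ⟨u, hu⟩ := exists_torusMonomial_ne_one h
    have h1 := integral_mul_right_eq_self (μ := torusHaar) (fun ω => torusMonomial α ω) u
    simp only [torusMonomial_apply_mul, integral_mul_const] at h1
    by_contra h2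
    exact hu (mul_left_cancel₀ h2 (h1.trans (mul_one _).symm))

/-- The star subalgebra of trigonometric polynomials. -/
noncomputable def torusPolynomials : StarSubalgebra ℂ C(InfTorus, ℂ) where
  toSubalgebra := Algebra.adjoin ℂ (Set.range torusMonomial)
  star_mem' := by
    change Algebra.adjoin ℂ (Set.range torusMonomial) ≤
      star (Algebra.adjoin ℂ (Set.range torusMonomial))
    refine Algebra.adjoin_le ?_
    rintro _ ⟨α, rfl⟩
    refine Algebra.subset_adjoin ⟨-α, ?_⟩
    ext1 ω
    simp only [torusMonomial_neg_apply, starRingEnd_apply, ContinuousMap.star_apply]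

lemma torusPolynomials_toSubmodule :
    torusPolynomials.toSubalgebra.toSubmodule = Submodule.span ℂ (Set.range torusMonomial) := by
  apply Algebra.adjoin_eq_span_of_subset
  refine .trans (fun x ↦ Submonoid.closure_induction (fun _ ↦ id) ⟨0, ?_⟩ ?_) Submodule.subset_span
  · ext ω
    simp [torusMonomial_zero_apply]
  · rintro _ _ _ _ ⟨m, rfl⟩ ⟨n, rfl⟩
    refine ⟨m + n, ?_⟩
    ext ω
    simp [torusMonomial_add_apply]

lemma torusPolynomials_separatesPoints : torusPolynomials.SeparatesPoints := by
  intro x y hxy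
  obtain ⟨i, hi⟩ := Function.ne_iff.1 hxy
  refine ⟨_, ⟨torusMonomial (Finsupp.single i 1),
    Algebra.subset_adjoin ⟨Finsupp.single i 1, rfl⟩, rfl⟩, ?_⟩
  simpa [torusMonomial_apply, Circle.ext_iff] using hi

/-- Trigonometric polynomials are uniformly dense in the continuous functions. -/
lemma span_torusMonomial_closure_eq_top :
    (Submodule.span ℂ (Set.range torusMonomial)).topologicalClosure = ⊤ := by
  rw [← torusPolynomials_toSubmodule]
  exact congr_arg (Subalgebra.toSubmodule <| StarSubalgebra.toSubalgebra ·)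
    (ContinuousMap.starSubalgebra_topologicalClosure_eq_top_of_separatesPoints _
      torusPolynomials_separatesPoints)

end Characters

/-! ## The Fejér kernel of the real line -/

section Fejer

open Filter Topology FourierTransform

/-- The triangle function `x ↦ (1 - |x|)₊`. -/
noncomputable def triangle (x : ℝ) : ℝ := max 0 (1 - |x|)

lemma continuous_triangle : Continuous triangle := by unfold triangle; fun_prop

lemma triangle_nonneg (x : ℝ) : 0 ≤ triangle x := le_max_left _ _

lemma triangle_eq_zero {x : ℝ} (hx : 1 ≤ |x|) : triangle x = 0 := max_eq_left (by linarith)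

lemma triangle_zero : triangle 0 = 1 := by simp [triangle]

lemma triangle_of_mem_Icc {x : ℝ} (hx : x ∈ Set.Icc (0 : ℝ) 1) : triangle x = 1 - x := by
  rw [triangle, abs_of_nonneg hx.1, max_eq_right (by linarith [hx.2])]

lemma triangle_of_mem_Icc_neg {x : ℝ} (hx : x ∈ Set.Icc (-1 : ℝ) 0) : triangle x = 1 + x := by
  rw [triangle, abs_of_nonpos hx.2, max_eq_right (by linarith [hx.1])]; ring

lemma hasCompactSupport_triangle : HasCompactSupport fun x => (triangle x : ℂ) := by
  refine HasCompactSupport.intro (isCompact_Icc (a := (-1 : ℝ)) (b := 1)) fun x hx => ?_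
  rw [triangle_eq_zero, Complex.ofReal_zero]
  by_contra! h
  exact hx (abs_le.1 h.le)

lemma integrable_triangle : Integrable fun x => (triangle x : ℂ) :=
  (Complex.continuous_ofReal.comp continuous_triangle).integrable_of_hasCompactSupport
    hasCompactSupport_triangle

/-- Explicit antiderivatives on `[-1, 0]` and `[0, 1]`; the value at `c = -2πiw` is the Fourier
transform of the triangle. -/
lemma integral_exp_mul_triangle {c : ℂ} (hc : c ≠ 0) :
    ∫ x : ℝ, Complex.exp (c * x) * triangle x = (Complex.exp c + Complex.exp (-c) - 2) / c ^ 2 := by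
  have hcont : Continuous fun x : ℝ => Complex.exp (c * x) * (triangle x : ℂ) := by
    have := continuous_triangle
    fun_prop
  have h1 : ∫ x : ℝ, Complex.exp (c * x) * triangle x =
      ∫ x in (-1 : ℝ)..1, Complex.exp (c * x) * triangle x := by
    rw [intervalIntegral.integral_of_le (by norm_num), setIntegral_eq_integral_of_forall_compl_eq_zero]
    intro x hx
    rw [triangle_eq_zero, Complex.ofReal_zero, mul_zero]
    by_contra! h
    exact hx ⟨(abs_lt.1 h).1, (abs_lt.1 h).2.le⟩
  have hexp (x : ℝ) : HasDerivAt (fun x : ℝ => Complex.exp (c * x)) (Complex.exp (c * x) * c) x := by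
    have := ((hasDerivAt_id (x : ℂ)).const_mul c).cexp.comp_ofReal
    simpa using this
  have hx (x : ℝ) : HasDerivAt (fun x : ℝ => (x : ℂ)) 1 x := (hasDerivAt_id (x : ℂ)).comp_ofReal
  have h2 : ∫ x in (0 : ℝ)..1, Complex.exp (c * x) * triangle x =
      Complex.exp c / c ^ 2 - (1 / c + 1 / c ^ 2) := by
    have : ∀ x ∈ Set.uIcc (0 : ℝ) 1, HasDerivAt (fun x : ℝ =>
        (1 - (x : ℂ)) * Complex.exp (c * x) / c + Complex.exp (c * x) / c ^ 2)
        (Complex.exp (c * x) * triangle x) x := by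
      intro x hx'
      rw [Set.uIcc_of_le zero_le_one] at hx'
      rw [triangle_of_mem_Icc hx']
      convert! ((((hx x).const_sub 1).mul (hexp x)).div_const c).add ((hexp x).div_const (c ^ 2)) using 1
      push_cast
      field_simp
      ring
    rw [intervalIntegral.integral_eq_sub_of_hasDerivAt this (hcont.intervalIntegrable _ _)]
    simp
  have h3 : ∫ x in (-1 : ℝ)..0, Complex.exp (c * x) * triangle x =
      (1 / c - 1 / c ^ 2) + Complex.exp (-c) / c ^ 2 := by
    have : ∀ x ∈ Set.uIcc (-1 : ℝ) 0, HasDerivAt (fun x : ℝ =>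
        (1 + (x : ℂ)) * Complex.exp (c * x) / c - Complex.exp (c * x) / c ^ 2)
        (Complex.exp (c * x) * triangle x) x := by
      intro x hx'
      rw [Set.uIcc_of_le (by norm_num)] at hx'
      rw [triangle_of_mem_Icc_neg hx']
      convert! ((((hx x).const_add 1).mul (hexp x)).div_const c).sub ((hexp x).div_const (c ^ 2)) using 1
      push_cast
      field_simp
      ring
    rw [intervalIntegral.integral_eq_sub_of_hasDerivAt this (hcont.intervalIntegrable _ _)]
    simp
  rw [h1, ← intervalIntegral.integral_add_adjacent_intervals (hcont.intervalIntegrable _ _)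
    (hcont.intervalIntegrable _ _), h2, h3]
  field_simp
  ring

lemma fourier_triangle {w : ℝ} (hw : w ≠ 0) :
    𝓕 (fun x => (triangle x : ℂ)) w =
      ((2 * (1 - Real.cos (2 * Real.pi * w)) / (2 * Real.pi * w) ^ 2 : ℝ) : ℂ) := by
  have hw' : (w : ℂ) ≠ 0 := by exact_mod_cast hw
  have hpi : (Real.pi : ℂ) ≠ 0 := by exact_mod_cast Real.pi_ne_zero
  have h := integral_exp_mul_triangle (c := -(2 * Real.pi * w) * Complex.I) (by simp [hw, Real.pi_ne_zero])
  rw [Real.fourier_eq']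
  calc _ = ∫ x : ℝ, Complex.exp (-(2 * Real.pi * w) * Complex.I * x) * triangle x := by
        refine integral_congr_ae (Eventually.of_forall fun x => ?_)
        simp only [smul_eq_mul, RCLike.inner_apply, conj_trivial]
        congr 2
        push_cast
        ring
    _ = _ := by
        rw [h]
        push_cast
        rw [Complex.cos, neg_mul, neg_neg, neg_sq, mul_pow, Complex.I_sq]
        field_simp
        ring

lemma fourier_triangle_zero : ∃ r : ℝ, 0 ≤ r ∧ 𝓕 (fun x => (triangle x : ℂ)) 0 = r := by
  refine ⟨∫ x, triangle x, integral_nonneg triangle_nonneg, ?_⟩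
  rw [Real.fourier_eq']
  simp [integral_complex_ofReal]

/-- The triangle function is the Fourier transform of a nonnegative integrable function. -/
lemma exists_fejer_kernel : ∃ φ : ℝ → ℝ, (∀ t, 0 ≤ φ t) ∧ Integrable φ ∧
    ∀ x : ℝ, ∫ t, (φ t : ℂ) * Complex.exp ((2 * Real.pi * (t * x) : ℝ) * Complex.I) = triangle x := by
  set F : ℝ → ℂ := 𝓕 (fun x => (triangle x : ℂ)) with hF
  have hFre (w : ℝ) : ∃ r : ℝ, 0 ≤ r ∧ F w = r := by
    rcases eq_or_ne w 0 with rfl | hw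
    · exact fourier_triangle_zero
    · refine ⟨_, ?_, fourier_triangle hw⟩
      have := Real.cos_le_one (2 * Real.pi * w)
      have : 0 ≤ 1 - Real.cos (2 * Real.pi * w) := by linarith
      positivity
  have hcont : Continuous F :=
    VectorFourier.fourierIntegral_continuous Real.continuous_fourierChar
      (by exact continuous_inner) integrable_triangle
  obtain ⟨M, hM⟩ : ∃ M, ∀ w, ‖F w‖ ≤ M :=
    ⟨_, fun w => VectorFourier.norm_fourierIntegral_le_integral_norm _ _ _ _ _⟩
  -- The numerator is at most 4 and `4 ≤ (2π)²`. Together with the bound `M` this gives `‖F w‖ (1 +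
  -- w²) ≤ M + 1`, hence integrability and the right to use Fourier inversion.
  have hdecay (w : ℝ) : ‖F w‖ * w ^ 2 ≤ 1 := by
    rcases eq_or_ne w 0 with rfl | hw
    · simp
    · have hw2 : 0 < w ^ 2 := by positivity
      have h1 := Real.neg_one_le_cos (2 * Real.pi * w)
      have h2 := Real.cos_le_one (2 * Real.pi * w)
      have hpi : 1 ≤ Real.pi ^ 2 := by nlinarith [Real.pi_gt_three]
      rw [hF, fourier_triangle hw, Complex.norm_real, Real.norm_of_nonneg]
      · rw [mul_pow, div_mul_eq_mul_div, div_le_one (by positivity)]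
        nlinarith [mul_le_mul_of_nonneg_right hpi hw2.le]
      · have : 0 ≤ 1 - Real.cos (2 * Real.pi * w) := by linarith
        positivity
  have hint : Integrable F := by
    refine (integrable_inv_one_add_sq.const_mul (M + 1)).mono' hcont.aestronglyMeasurable
      (Eventually.of_forall fun w => ?_)
    rw [← div_eq_mul_inv, le_div_iff₀ (by positivity)]
    linarith [hM w, hdecay w]
  refine ⟨fun t => (F t).re, fun t => ?_, hint.re, fun x => ?_⟩
  · obtain ⟨r, hr, h⟩ := hFre t
    simpa [h] using hr
  · have h := congr_fun (Continuous.fourierInv_fourier_eq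
      (Complex.continuous_ofReal.comp continuous_triangle) integrable_triangle hint) x
    rw [Real.fourierInv_eq'] at h
    refine Eq.trans (integral_congr_ae (Eventually.of_forall fun t => ?_)) h
    obtain ⟨r, hr, h⟩ := hFre t
    have h' : 𝓕 ((fun x : ℝ => (x : ℂ)) ∘ triangle) t = r := h
    simp only [smul_eq_mul, RCLike.inner_apply, conj_trivial, h, Complex.ofReal_re]
    refine Eq.trans ?_ (congrArg _ h'.symm)
    rw [mul_comm, mul_comm t x]

end Fejer

/-! ## The Poisson kernel as a mixture of Fejér kernels -/

section Poisson

open Filter Topology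

/-- The density, in the radius `R`, that mixes the functions `x ↦ (1 - |x| / R)₊` into
`x ↦ exp (-ε |x|)`. -/
noncomputable def mixDensity (ε R : ℝ) : ℝ := ε ^ 2 * R * Real.exp (-ε * R)

lemma mixDensity_nonneg (ε : ℝ) {R : ℝ} (hR : 0 ≤ R) : 0 ≤ mixDensity ε R := by
  unfold mixDensity; positivity

lemma tendsto_affine_mul_exp_neg {ε : ℝ} (hε : 0 < ε) (x : ℝ) :
    Tendsto (fun R => -(ε * (R - x) + 1) * Real.exp (-ε * R)) atTop (𝓝 0) := by
  have h0 : Tendsto (fun R => ε * R) atTop atTop := tendsto_id.const_mul_atTop hε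
  have h1 := (Real.tendsto_pow_mul_exp_neg_atTop_nhds_zero 1).comp h0
  have h2 := (Real.tendsto_pow_mul_exp_neg_atTop_nhds_zero 0).comp h0
  have h3 := h1.neg.add (h2.const_mul (ε * x - 1))
  simp only [neg_zero, mul_zero, add_zero] at h3
  refine h3.congr fun R => ?_
  simp only [Function.comp_apply, pow_one, pow_zero, one_mul, neg_mul]
  ring

lemma hasDerivAt_affine_mul_exp_neg (ε x R : ℝ) :
    HasDerivAt (fun R => -(ε * (R - x) + 1) * Real.exp (-ε * R))
      (ε ^ 2 * (R - x) * Real.exp (-ε * R)) R := by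
  have h1 : HasDerivAt (fun R => -(ε * (R - x) + 1)) (-ε) R := by
    simpa only [mul_one, id_eq] using ((((hasDerivAt_id R).sub_const x).const_mul ε).add_const 1).fun_neg
  have h2 : HasDerivAt (fun R => Real.exp (-ε * R)) (Real.exp (-ε * R) * -ε) R := by
    simpa using ((hasDerivAt_id R).const_mul (-ε)).exp
  convert! h1.mul h2 using 1
  ring

/-- The factor `R` of the density clears the denominator: `R (1 - |x| / R)₊ = (R - |x|)₊`, which has
an elementary antiderivative against `exp (-ε R)`. -/
lemma mixDensity_mul_triangle {ε x R : ℝ} (hR : 0 < R) :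
    mixDensity ε R * triangle (x / R) =
      (Set.Ioi |x|).indicator (fun R => ε ^ 2 * (R - |x|) * Real.exp (-ε * R)) R := by
  by_cases h : |x| < R
  · rw [Set.indicator_of_mem (Set.mem_Ioi.2 h), triangle, abs_div, abs_of_pos hR, max_eq_right, mixDensity]
    · field_simp
    · rw [sub_nonneg, div_le_one hR]; exact h.le
  · rw [Set.indicator_of_notMem (mt Set.mem_Ioi.1 h), triangle_eq_zero, mul_zero]
    rw [abs_div, abs_of_pos hR, one_le_div hR]
    exact not_lt.1 h

lemma integral_mixDensity_mul_triangle {ε : ℝ} (hε : 0 < ε) (x : ℝ) :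
    ∫ R in Set.Ioi 0, mixDensity ε R * triangle (x / R) = Real.exp (-ε * |x|) := by
  rw [setIntegral_congr_fun measurableSet_Ioi fun R hR => mixDensity_mul_triangle hR,
    setIntegral_indicator measurableSet_Ioi,
    Set.inter_eq_self_of_subset_right (Set.Ioi_subset_Ioi (abs_nonneg x)),
    integral_Ioi_of_hasDerivAt_of_nonneg' (fun R _ => hasDerivAt_affine_mul_exp_neg ε |x| R) ?_
      (tendsto_affine_mul_exp_neg hε |x|)]
  · simp
  · intro R hR
    have : 0 ≤ R - |x| := sub_nonneg.2 (le_of_lt hR)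
    positivity

lemma integrableOn_mixDensity {ε : ℝ} (hε : 0 < ε) : IntegrableOn (mixDensity ε) (Set.Ioi 0) := by
  have h := integrableOn_Ioi_deriv_of_nonneg' (a := 0)
    (fun R _ => hasDerivAt_affine_mul_exp_neg ε 0 R) ?_ (tendsto_affine_mul_exp_neg hε 0)
  · simp only [sub_zero] at h
    exact h
  · intro R hR
    have : 0 ≤ R - 0 := by simpa using le_of_lt hR
    positivity

lemma integral_mixDensity {ε : ℝ} (hε : 0 < ε) : ∫ R in Set.Ioi 0, mixDensity ε R = 1 := by
  simpa [triangle_zero] using integral_mixDensity_mul_triangle hε 0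

/-- The density has total mass 1, so its tails vanish; this makes the contribution of large radii
negligible, uniformly in `N`. -/
lemma exists_integral_mixDensity_lt {ε δ : ℝ} (hε : 0 < ε) (hδ : 0 < δ) :
    ∃ r, 0 < r ∧ ∫ R in Set.Ioi r, mixDensity ε R < δ := by
  have h1 := intervalIntegral_tendsto_integral_Ioi 0 (integrableOn_mixDensity hε) tendsto_id
  rw [integral_mixDensity hε] at h1
  obtain ⟨r, hr, hr0⟩ :=
    ((h1.eventually (lt_mem_nhds (show 1 - δ < 1 by linarith))).and (eventually_gt_atTop 0)).exists
  refine ⟨r, hr0, ?_⟩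
  have h2 := intervalIntegral.integral_Ioi_sub_Ioi (integrableOn_mixDensity hε) (le_of_lt hr0)
  rw [integral_mixDensity hε] at h2
  simp only [id_eq] at hr
  linarith

lemma integrableOn_mixDensity_mul_triangle {ε : ℝ} (hε : 0 < ε) (x : ℝ) :
    IntegrableOn (fun R => mixDensity ε R * triangle (x / R)) (Set.Ioi 0) := by
  refine (integrableOn_mixDensity hε).mul_bdd (c := 1) ?_ ?_
  · exact (continuous_triangle.measurable.comp (by fun_prop)).aestronglyMeasurable
  · refine Eventually.of_forall fun R => ?_
    rw [Real.norm_of_nonneg (triangle_nonneg _), triangle]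
    exact max_le zero_le_one (by linarith [abs_nonneg (x / R)])

variable {V ι : Type*} [NormedAddCommGroup V] [NormedSpace ℂ V] [CompleteSpace V]

/-- Mixing bounds for the multipliers `(1 - |l| / R)₊` over all radii `R > r`. -/
lemma norm_sum_mix_smul_le {ε r C : ℝ} (hε : 0 < ε) (hr : 0 ≤ r) (A : Finset ι) (l : ι → ℝ)
    (v : ι → V) (hv : ∀ R : ℝ, 0 < R → ‖∑ α ∈ A, (triangle (l α / R) : ℂ) • v α‖ ≤ C) :
    ‖∑ α ∈ A, ((∫ R in Set.Ioi r, mixDensity ε R * triangle (l α / R) : ℝ) : ℂ) • v α‖ ≤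
      (∫ R in Set.Ioi r, mixDensity ε R) * C := by
  have hsub : Set.Ioi r ⊆ Set.Ioi 0 := Set.Ioi_subset_Ioi hr
  have h1 : ∑ α ∈ A, ((∫ R in Set.Ioi r, mixDensity ε R * triangle (l α / R) : ℝ) : ℂ) • v α =
      ∫ R in Set.Ioi r, ∑ α ∈ A, ((mixDensity ε R * triangle (l α / R) : ℝ) : ℂ) • v α := by
    rw [integral_finsetSum]
    · refine Finset.sum_congr rfl fun α _ => ?_
      rw [integral_smul_const, integral_complex_ofReal]
    · intro α _
      exact (((integrableOn_mixDensity_mul_triangle hε (l α)).mono_set hsub).ofReal).smul_const _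
  rw [h1, ← integral_mul_const]
  refine norm_integral_le_of_norm_le (((integrableOn_mixDensity hε).mono_set hsub).mul_const C) ?_
  filter_upwards [ae_restrict_mem measurableSet_Ioi] with R hR
  have hR0 : 0 < R := hsub hR
  have h2 : ∑ α ∈ A, ((mixDensity ε R * triangle (l α / R) : ℝ) : ℂ) • v α =
      (mixDensity ε R : ℂ) • ∑ α ∈ A, (triangle (l α / R) : ℂ) • v α := by
    rw [Finset.smul_sum]
    refine Finset.sum_congr rfl fun α _ => ?_
    rw [smul_smul, Complex.ofReal_mul]
  rw [h2, norm_smul, Complex.norm_real, Real.norm_of_nonneg (mixDensity_nonneg ε hR0.le)]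
  exact mul_le_mul_of_nonneg_left (hv R hR0) (mixDensity_nonneg ε hR0.le)

/-- Sums that are bounded under all multipliers `(1 - |l| / R)₊` and converge termwise, converge in
norm once they are damped by `exp (-ε |l|)`, provided that only finitely many terms have
bounded frequency. -/
lemma exists_tendsto_sum_exp_smul {ε C : ℝ} (hε : 0 < ε) (l : ι → ℝ) (v : ι → V)
    (A : ℕ → Finset ι) (k : ℕ → ι → ℂ) (hkA : ∀ N, ∀ α ∉ A N, k N α = 0)
    (hk : ∀ α, Tendsto (fun N => k N α) atTop (𝓝 1))
    (hfin : ∀ r : ℝ, {α | v α ≠ 0 ∧ |l α| < r}.Finite)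
    (hC : ∀ N, ∀ R : ℝ, 0 < R →
      ‖∑ α ∈ A N, (triangle (l α / R) : ℂ) • k N α • v α‖ ≤ C) :
    ∃ g : V, ‖g‖ ≤ C ∧
      Tendsto (fun N => ∑ α ∈ A N, (Real.exp (-ε * |l α|) : ℂ) • k N α • v α) atTop (𝓝 g) := by
  set G : ℕ → V := fun N => ∑ α ∈ A N, (Real.exp (-ε * |l α|) : ℂ) • k N α • v α with hG
  have hC0 : 0 ≤ C := (norm_nonneg _).trans (hC 0 1 one_pos)
  have hbound (N : ℕ) : ‖G N‖ ≤ C := by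
    have h := norm_sum_mix_smul_le hε le_rfl (A N) l _ (hC N)
    simpa only [integral_mixDensity_mul_triangle hε, integral_mixDensity hε, one_mul] using h
  -- The mixture is cut at radius `r`. Radii `R ≤ r` see only frequencies below `r`, a fixed finite
  -- set of nonzero terms, so that part converges termwise; radii `R > r` cost at most the tail mass
  -- times `C`.
  have hcut (r : ℝ) (hr : 0 < r) : ∃ u : ℕ → V, CauchySeq u ∧
      ∀ N, ‖G N - u N‖ ≤ (∫ R in Set.Ioi r, mixDensity ε R) * C := by
    set m : ι → ℝ := fun α => ∫ R in Set.Ioc 0 r, mixDensity ε R * triangle (l α / R) with hm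
    have hm0 {α : ι} (hα : r ≤ |l α|) : m α = 0 := by
      refine setIntegral_eq_zero_of_forall_eq_zero fun R hR => ?_
      rw [triangle_eq_zero, mul_zero]
      rw [abs_div, abs_of_pos hR.1, one_le_div hR.1]
      exact hR.2.trans hα
    refine ⟨fun N => ∑ α ∈ A N, (m α : ℂ) • k N α • v α, ?_, fun N => ?_⟩
    · have heq (N : ℕ) : ∑ α ∈ A N, (m α : ℂ) • k N α • v α =
          ∑ α ∈ (hfin r).toFinset, (m α : ℂ) • k N α • v α := by
        classical
        have h1 : ∑ α ∈ A N, (m α : ℂ) • k N α • v α =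
            ∑ α ∈ A N ∪ (hfin r).toFinset, (m α : ℂ) • k N α • v α := by
          refine Finset.sum_subset Finset.subset_union_left fun α _ hα => ?_
          rw [hkA N α hα, zero_smul, smul_zero]
        rw [h1]
        symm
        refine Finset.sum_subset Finset.subset_union_right fun α _ hα => ?_
        rw [Set.Finite.mem_toFinset, Set.mem_ofPred_eq, not_and_or, not_not, not_lt] at hα
        rcases hα with hα | hα
        · rw [hα, smul_zero, smul_zero]
        · rw [hm0 hα, Complex.ofReal_zero, zero_smul]
      simp only [heq]
      exact (tendsto_finsetSum _ fun α _ =>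
        (((hk α).smul_const (v α)).const_smul (m α : ℂ))).cauchySeq
    · have h := norm_sum_mix_smul_le hε hr.le (A N) l _ (hC N)
      refine le_of_eq_of_le ?_ h
      rw [hG, ← Finset.sum_sub_distrib]
      congr 1
      refine Finset.sum_congr rfl fun α _ => ?_
      rw [← sub_smul, ← Complex.ofReal_sub, ← integral_mixDensity_mul_triangle hε (l α),
        ← Set.Ioc_union_Ioi_eq_Ioi hr.le, setIntegral_union Set.Ioc_disjoint_Ioi_same
          measurableSet_Ioi]
      · rw [hm, add_sub_cancel_left]
      · exact (integrableOn_mixDensity_mul_triangle hε (l α)).mono_set Set.Ioc_subset_Ioi_self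
      · exact (integrableOn_mixDensity_mul_triangle hε (l α)).mono_set (Set.Ioi_subset_Ioi hr.le)
  have hcauchy : CauchySeq G := by
    rw [Metric.cauchySeq_iff']
    intro δ hδ
    -- `C` may be 0, so the tail is compared with `C + 1`; multiplied by `C` it is still at most `δ
    -- / 3`.
    obtain ⟨r, hr, hrδ⟩ := exists_integral_mixDensity_lt (δ := δ / (3 * (C + 1))) hε (by positivity)
    obtain ⟨u, hu, huG⟩ := hcut r hr
    have hsmall (N : ℕ) : ‖G N - u N‖ ≤ δ / 3 := by
      refine (huG N).trans ?_
      have h1 := mul_le_mul_of_nonneg_right hrδ.le hC0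
      refine h1.trans ?_
      rw [div_mul_eq_mul_div, div_le_div_iff₀ (by positivity) (by positivity)]
      nlinarith
    obtain ⟨N, hN⟩ := Metric.cauchySeq_iff'.1 hu (δ / 3) (by positivity)
    refine ⟨N, fun n hn => ?_⟩
    have h1 := hN n hn
    have h2 := hsmall n
    have h3 := hsmall N
    rw [← dist_eq_norm] at h2 h3
    rw [dist_comm] at h3
    linarith [dist_triangle4 (G n) (u n) (u N) (G N)]
  obtain ⟨g, hg⟩ := cauchySeq_tendsto_of_complete hcauchy
  exact ⟨g, le_of_tendsto hg.norm (Eventually.of_forall hbound), hg⟩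

end Poisson

/-! ## Translations and the Dirichlet flow on the torus -/

section Flow

open Filter Topology

/-- The translate `y ↦ f (y u)` of a continuous function on the torus. -/
noncomputable def torusTranslate {Y : Type*} [TopologicalSpace Y] (u : InfTorus) (f : C(InfTorus, Y)) :
    C(InfTorus, Y) := f.comp ⟨fun ω => ω * u, continuous_mul_const u⟩

lemma torusTranslate_apply {Y : Type*} [TopologicalSpace Y] (u : InfTorus) (f : C(InfTorus, Y))
    (ω : InfTorus) : torusTranslate u f ω = f (ω * u) := rfl

lemma continuous_torusTranslate {Y : Type*} [TopologicalSpace Y] (f : C(InfTorus, Y)) :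
    Continuous fun u => torusTranslate u f := by
  let F : C(InfTorus × InfTorus, Y) := f.comp ⟨fun z => z.2 * z.1, continuous_snd.mul continuous_fst⟩
  exact ContinuousMap.continuous_of_continuous_uncurry _ F.continuous

lemma norm_toLp_torusTranslate (p : ℝ≥0∞) [Fact (1 ≤ p)] (u : InfTorus) (f : C(InfTorus, X)) :
    ‖ContinuousMap.toLp p torusHaar ℂ (torusTranslate u f)‖ =
      ‖ContinuousMap.toLp p torusHaar ℂ f‖ := by
  rw [Lp.norm_def, Lp.norm_def, eLpNorm_congr_ae (ContinuousMap.coeFn_toLp _ _),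
    eLpNorm_congr_ae (ContinuousMap.coeFn_toLp _ f)]
  have h := eLpNorm_comp_measurePreserving (p := p)
    (f.continuous.aestronglyMeasurable (μ := torusHaar)) (measurePreserving_mul_right torusHaar u)
  rw [← h]
  rfl

lemma norm_torusTranslate {Y : Type*} [NormedAddCommGroup Y] (u : InfTorus) (f : C(InfTorus, Y)) :
    ‖torusTranslate u f‖ = ‖f‖ := by
  refine le_antisymm ?_ ?_
  · exact (ContinuousMap.norm_le _ (norm_nonneg _)).2 fun ω => f.norm_coe_le_norm _
  · refine (ContinuousMap.norm_le _ (norm_nonneg _)).2 fun ω => ?_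
    have h := (torusTranslate u f).norm_coe_le_norm (ω * u⁻¹)
    rwa [torusTranslate_apply, inv_mul_cancel_right] at h

/-- The `X`-valued monomial `ω ↦ ω^α x`. -/
noncomputable def monomialVec (α : ℕ →₀ ℤ) (x : X) : C(InfTorus, X) where
  toFun ω := torusMonomial α ω • x
  continuous_toFun := (torusMonomial α).continuous.smul continuous_const

/-- The `X`-valued monomial `ω ↦ ω^α x` as an element of `L_p`. -/
noncomputable def monomialLp (p : ℝ≥0∞) [Fact (1 ≤ p)] (α : ℕ →₀ ℤ) (x : X) : Lp X p torusHaar :=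
  ContinuousMap.toLp p torusHaar ℂ (monomialVec α x)

lemma monomialVec_apply (α : ℕ →₀ ℤ) (x : X) (ω : InfTorus) :
    monomialVec α x ω = torusMonomial α ω • x := rfl

lemma monomialVec_smul (α : ℕ →₀ ℤ) (c : ℂ) (x : X) :
    monomialVec α (c • x) = c • monomialVec α x := by
  ext ω; simp [monomialVec_apply, smul_comm c]

lemma monomialLp_smul (p : ℝ≥0∞) [Fact (1 ≤ p)] (α : ℕ →₀ ℤ) (c : ℂ) (x : X) :
    monomialLp p α (c • x) = c • monomialLp p α x := by
  simp [monomialLp, monomialVec_smul]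

lemma monomialLp_zero (p : ℝ≥0∞) [Fact (1 ≤ p)] (α : ℕ →₀ ℤ) :
    monomialLp p α (0 : X) = 0 := by
  simpa using monomialLp_smul p α 0 (0 : X)

lemma torusTranslate_monomialVec (u : InfTorus) (α : ℕ →₀ ℤ) (x : X) :
    torusTranslate u (monomialVec α x) = torusMonomial α u • monomialVec α x := by
  ext ω
  simp [torusTranslate_apply, monomialVec_apply, torusMonomial_apply_mul, smul_smul, mul_comm]

lemma torusTranslate_sum {ι Y : Type*} [NormedAddCommGroup Y] (u : InfTorus) (A : Finset ι)
    (f : ι → C(InfTorus, Y)) :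
    torusTranslate u (∑ i ∈ A, f i) = ∑ i ∈ A, torusTranslate u (f i) := by
  ext ω; simp [torusTranslate_apply]

/-- Multiplying the `α`-th coefficient by `u^α` is translation by `u`, which preserves Haar measure.
-/
lemma norm_sum_torusMonomial_smul_monomialLp (p : ℝ≥0∞) [Fact (1 ≤ p)] (u : InfTorus)
    (A : Finset (ℕ →₀ ℤ)) (c : (ℕ →₀ ℤ) → X) :
    ‖∑ α ∈ A, torusMonomial α u • monomialLp p α (c α)‖ = ‖∑ α ∈ A, monomialLp p α (c α)‖ := by
  have h := norm_toLp_torusTranslate p u (∑ α ∈ A, monomialVec α (c α))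
  rw [torusTranslate_sum, map_sum, map_sum] at h
  refine Eq.trans (congrArg _ ?_) h
  refine Finset.sum_congr rfl fun α _ => ?_
  rw [torusTranslate_monomialVec, map_smul, monomialLp]

/-- The frequency `∑ α_j log 𝔭_j` of the character `ω^α` along the flow `𝔭^{it}`. -/
noncomputable def logWeight (α : ℕ →₀ ℤ) : ℝ := α.sum fun j k => k * Real.log (Nat.nth Nat.Prime j)

/-- The point `𝔭^{it}` of the torus. -/
noncomputable def primeFlow (t : ℝ) : InfTorus := fun j => Circle.exp (t * Real.log (Nat.nth Nat.Prime j))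

lemma Circle.exp_finsetSum {ι : Type*} (A : Finset ι) (f : ι → ℝ) :
    Circle.exp (∑ i ∈ A, f i) = ∏ i ∈ A, Circle.exp (f i) := by
  classical
  induction A using Finset.induction_on with
  | empty => simp
  | insert i A hi h => rw [Finset.sum_insert hi, Finset.prod_insert hi, Circle.exp_add, h]

/-- Along the flow a character of the torus becomes an exponential of the line, so a multiplier
depending on `logWeight` alone can be written as an average of translations of the torus. -/
lemma torusMonomial_primeFlow (α : ℕ →₀ ℤ) (t : ℝ) :
    torusMonomial α (primeFlow t) = Complex.exp ((t * logWeight α : ℝ) * Complex.I) := by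
  rw [← Circle.coe_exp, torusMonomial_apply, logWeight, Finsupp.sum, Finset.mul_sum,
    Circle.exp_finsetSum, Finsupp.prod]
  congr 1
  refine Finset.prod_congr rfl fun j _ => ?_
  rw [primeFlow, ← Circle.exp_zsmul, zsmul_eq_mul]
  congr 1
  ring

lemma logWeight_natIndex (α : ℕ →₀ ℕ) : logWeight (natIndex α) = Real.log (primePow α : ℕ) := by
  have h : ((primePow α : ℕ) : ℝ) = ∏ j ∈ α.support, (Nat.nth Nat.Prime j : ℝ) ^ α j := by
    simp [primePow, Finsupp.prod]
  rw [h, Real.log_prod, logWeight, natIndex, Finsupp.sum_mapRange_index (by simp), Finsupp.sum]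
  · simp
  · intro j _
    exact pow_ne_zero _ (by exact_mod_cast (Nat.prime_nth_prime j).ne_zero)

lemma logWeight_natIndex_nonneg (α : ℕ →₀ ℕ) : 0 ≤ logWeight (natIndex α) := by
  rw [logWeight_natIndex]; exact Real.log_natCast_nonneg _

lemma natIndex_apply (α : ℕ →₀ ℕ) (j : ℕ) : natIndex α j = α j := rfl

lemma exists_natIndex_eq {α : ℕ →₀ ℤ} (hα : ¬ ∃ j, α j < 0) : ∃ β, natIndex β = α := by
  push Not at hα
  refine ⟨α.mapRange Int.toNat rfl, ?_⟩
  ext j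
  simp [natIndex_apply, hα j]

/-- Only finitely many monomials of a power series have bounded frequency. -/
lemma finite_setOf_logWeight_lt (r : ℝ) :
    {α : ℕ →₀ ℤ | (¬ ∃ j, α j < 0) ∧ |logWeight α| < r}.Finite := by
  have h1 : {β : ℕ →₀ ℕ | |logWeight (natIndex β)| < r}.Finite := by
    have h2 : {n : ℕ+ | (n : ℕ) ≤ ⌊Real.exp r⌋₊}.Finite :=
      (Set.finite_Iic ⌊Real.exp r⌋₊).preimage PNat.coe_injective.injOn
    refine (h2.preimage primePowEquiv.injective.injOn).subset fun β hβ => ?_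
    rw [Set.mem_ofPred_eq, abs_of_nonneg (logWeight_natIndex_nonneg β), logWeight_natIndex] at hβ
    refine Nat.le_floor ?_
    exact ((Real.log_lt_iff_lt_exp (by exact_mod_cast (primePow β).pos)).1 hβ).le
  refine (h1.image natIndex).subset ?_
  rintro α ⟨hα, hr⟩
  obtain ⟨β, rfl⟩ := exists_natIndex_eq hα
  exact ⟨β, hr, rfl⟩

/-- The Riesz means `c_α ↦ (1 - |log 𝔭^α| / R)₊ c_α` are contractions in `L_p`. -/
lemma norm_sum_triangle_smul_monomialLp_le [CompleteSpace X] (p : ℝ≥0∞) [Fact (1 ≤ p)] (R : ℝ)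
    (A : Finset (ℕ →₀ ℤ)) (c : (ℕ →₀ ℤ) → X) :
    ‖∑ α ∈ A, (triangle (logWeight α / R) : ℂ) • monomialLp p α (c α)‖ ≤
      ‖∑ α ∈ A, monomialLp p α (c α)‖ := by
  obtain ⟨φ, hφ0, hφ, hφt⟩ := exists_fejer_kernel
  -- Running the flow at speed `2π / R` turns the Fourier representation of the triangle, evaluated
  -- at `logWeight α / R`, into values of characters.
  have hflow (t : ℝ) (α : ℕ →₀ ℤ) :
      Complex.exp ((2 * Real.pi * (t * (logWeight α / R)) : ℝ) * Complex.I) =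
        torusMonomial α (primeFlow (2 * Real.pi * t / R)) := by
    rw [torusMonomial_primeFlow]; congr 3; ring
  have hint (α : ℕ →₀ ℤ) : Integrable fun t : ℝ =>
      (φ t : ℂ) * torusMonomial α (primeFlow (2 * Real.pi * t / R)) := by
    refine hφ.ofReal.mul_bdd (c := 1) ?_ (Eventually.of_forall fun t =>
      (norm_torusMonomial_apply _ _).le)
    simp only [torusMonomial_primeFlow]
    exact Continuous.aestronglyMeasurable (by fun_prop)
  have h1 : ∑ α ∈ A, (triangle (logWeight α / R) : ℂ) • monomialLp p α (c α) =
      ∫ t, (φ t : ℂ) • ∑ α ∈ A, torusMonomial α (primeFlow (2 * Real.pi * t / R)) •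
        monomialLp p α (c α) := by
    simp only [Finset.smul_sum, smul_smul]
    rw [integral_finsetSum _ fun α _ => (hint α).smul_const _]
    refine Finset.sum_congr rfl fun α _ => ?_
    rw [integral_smul_const, ← hφt]
    simp only [hflow]
  -- The mass of the kernel is the value of its Fourier transform at 0, that is `triangle 0 = 1`;
  -- with `φ ≥ 0` this makes the average a contraction.
  have h2 : ∫ t, φ t = 1 := by
    have := hφt 0
    simp only [mul_zero, Complex.ofReal_zero, zero_mul, Complex.exp_zero, mul_one,
      integral_complex_ofReal, triangle_zero] at this
    exact_mod_cast this
  rw [h1]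
  calc _ ≤ ∫ t, φ t * ‖∑ α ∈ A, monomialLp p α (c α)‖ := by
        refine norm_integral_le_of_norm_le (hφ.mul_const _) (Eventually.of_forall fun t => ?_)
        rw [norm_smul, norm_sum_torusMonomial_smul_monomialLp, Complex.norm_real,
          Real.norm_of_nonneg (hφ0 t)]
    _ = _ := by rw [integral_mul_const, h2, one_mul]

end Flow

/-! ## The duality pairing and Fourier coefficients -/

section Pairing

open Filter Topology

lemma Lp_coeFn_finsetSum {ι Ω Y : Type*} [MeasurableSpace Ω] {μ : Measure Ω} [NormedAddCommGroup Y]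
    {p : ℝ≥0∞} (s : Finset ι) (g : ι → Lp Y p μ) :
    ⇑(∑ i ∈ s, g i) =ᵐ[μ] fun ω => ∑ i ∈ s, g i ω := by
  classical
  induction s using Finset.induction_on with
  | empty =>
    simp only [Finset.sum_empty]
    exact Lp.coeFn_zero Y p μ
  | insert i s hi h =>
    rw [Finset.sum_insert hi]
    filter_upwards [Lp.coeFn_add (g i) (∑ i ∈ s, g i), h] with ω h1 h2
    rw [h1, Pi.add_apply, h2, Finset.sum_insert hi]

variable [CompleteSpace X] (p q : ℝ≥0∞) [Fact (1 ≤ p)] [Fact (1 ≤ q)] [ENNReal.HolderConjugate p q]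

/-- The pairing `(f, g) ↦ ∫ g f` of `L_p(𝕋^ℕ, X)` and `L_q(𝕋^ℕ)`. -/
noncomputable def torusPairing : Lp X p torusHaar →L[ℂ] Lp ℂ q torusHaar →L[ℂ] X :=
  (ContinuousLinearMap.lsmul ℂ ℂ : ℂ →L[ℂ] X →L[ℂ] X).flip.lpPairing torusHaar p q

lemma torusPairing_apply (f : Lp X p torusHaar) (g : Lp ℂ q torusHaar) :
    torusPairing p q f g = ∫ ω, g ω • f ω ∂torusHaar := by
  rw [torusPairing, ContinuousLinearMap.lpPairing_eq_integral]; rfl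

lemma torusPairing_lpMonomial (f : Lp X p torusHaar) (α : ℕ →₀ ℤ) :
    torusPairing p q f (lpMonomial q α) = torusFourierCoeff p (-α) f := by
  rw [torusPairing_apply]
  refine integral_congr_ae ?_
  filter_upwards [ContinuousMap.coeFn_toLp (𝕜 := ℂ) (p := q) torusHaar (torusMonomial α)] with ω h
  rw [neg_neg, lpMonomial, h]

lemma torusFourierCoeff_monomialLp (α β : ℕ →₀ ℤ) (x : X) :
    torusFourierCoeff p β (monomialLp p α x) = if α = β then x else 0 := by
  have h : torusFourierCoeff p β (monomialLp p α x) =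
      ∫ ω, torusMonomial (-β + α) ω • x ∂torusHaar := by
    refine integral_congr_ae ?_
    filter_upwards [ContinuousMap.coeFn_toLp (𝕜 := ℂ) (p := p) torusHaar (monomialVec α x)] with ω h
    rw [monomialLp, h, torusMonomial_add_apply, monomialVec_apply, smul_smul]
  rw [h, integral_smul_const, integral_torusMonomial]
  simp only [neg_add_eq_zero, eq_comm (a := β)]
  split_ifs <;> simp

lemma norm_torusPairing_le_integral (f : Lp X p torusHaar) (g : Lp ℂ q torusHaar) :
    ‖torusPairing p q f g‖ ≤ ∫ ω, ‖g ω‖ * ‖f ω‖ ∂torusHaar := by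
  rw [torusPairing_apply]
  refine (norm_integral_le_integral_norm _).trans_eq ?_
  simp only [norm_smul]

omit [CompleteSpace X] [Fact (1 ≤ p)] [Fact (1 ≤ q)] in
lemma integral_norm_mul_norm_le (f : Lp X p torusHaar) (g : Lp ℂ q torusHaar) :
    ∫ ω, ‖g ω‖ * ‖f ω‖ ∂torusHaar ≤ ‖f‖ * ‖g‖ := by
  have h := ENNReal.toReal_mono (by finiteness)
    (eLpNorm_smul_le_mul_eLpNorm (p := q) (q := p) (r := 1)
      (Lp.aestronglyMeasurable f) (Lp.aestronglyMeasurable g))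
  rw [ENNReal.toReal_mul, ← Lp.norm_def, ← Lp.norm_def, mul_comm] at h
  refine le_of_eq_of_le ?_ h
  rw [eLpNorm_one_eq_lintegral_enorm, ← integral_norm_eq_lintegral_enorm
    ((Lp.aestronglyMeasurable g).smul (Lp.aestronglyMeasurable f))]
  simp only [Pi.smul_apply', norm_smul]

lemma norm_torusPairing_le (f : Lp X p torusHaar) (g : Lp ℂ q torusHaar) :
    ‖torusPairing p q f g‖ ≤ ‖f‖ * ‖g‖ :=
  (norm_torusPairing_le_integral p q f g).trans (integral_norm_mul_norm_le p q f g)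

/-- For positive functions `∑ |g_i| = |∑ g_i|`, so Hölder's inequality is applied once, to the sum.
-/
lemma sum_norm_torusPairing_le {n : ℕ} (f : Lp X p torusHaar) (g : Fin n → Lp ℂ q torusHaar)
    (hg : ∀ i, 0 ≤ g i) : ∑ i, ‖torusPairing p q f (g i)‖ ≤ ‖f‖ * ‖∑ i, g i‖ := by
  have hint (h : Lp ℂ q torusHaar) : Integrable (fun ω => ‖h ω‖ * ‖f ω‖) torusHaar :=
    memLp_one_iff_integrable.1 ((Lp.memLp f).norm.mul (Lp.memLp h).norm)
  have h1 : ∑ i, ‖torusPairing p q f (g i)‖ ≤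
      ∫ ω, ‖(∑ i, g i : Lp ℂ q torusHaar) ω‖ * ‖f ω‖ ∂torusHaar := by
    calc _ ≤ ∑ i, ∫ ω, ‖g i ω‖ * ‖f ω‖ ∂torusHaar := by
          refine Finset.sum_le_sum fun i _ => ?_
          exact norm_torusPairing_le_integral p q f (g i)
      _ = ∫ ω, ∑ i, ‖g i ω‖ * ‖f ω‖ ∂torusHaar := (integral_finsetSum _ fun i _ => hint _).symm
      _ = _ := by
          refine integral_congr_ae ?_
          have h2 : ∀ᵐ ω ∂torusHaar, ∀ i, 0 ≤ g i ω := by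
            rw [ae_all_iff]; intro i
            have := (Lp.coeFn_nonneg (g i)).2 (hg i)
            filter_upwards [this] with ω h using h
          filter_upwards [h2, Lp_coeFn_finsetSum Finset.univ g] with ω h2 h3
          rw [h3, ← Finset.sum_mul]
          congr 1
          have h4 (i) : g i ω = (‖g i ω‖ : ℂ) := Complex.eq_coe_norm_of_nonneg (h2 i)
          rw [Finset.sum_congr rfl fun i _ => h4 i, ← Complex.ofReal_sum, Complex.norm_real,
            Real.norm_of_nonneg (Finset.sum_nonneg fun i _ => norm_nonneg _)]
  exact h1.trans (integral_norm_mul_norm_le p q f _)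

end Pairing

/-! ## Fejér kernels on the torus -/

section TorusFejer

open Filter Topology

/-- The box of exponents `β` with `0 ≤ β_j ≤ N` for `j ≤ N` and `β_j = 0` for `j > N`. -/
noncomputable def fejerBox (N : ℕ) : Finset (ℕ →₀ ℤ) :=
  (Finset.range (N + 1)).finsupp fun _ => Finset.Ico 0 ((N : ℤ) + 1)

lemma card_fejerBox (N : ℕ) : (fejerBox N).card = (N + 1) ^ (N + 1) := by
  rw [fejerBox, Finset.card_finsupp]
  simp only [Int.card_Ico, Finset.prod_const, Finset.card_range, sub_zero]
  congr 1

lemma card_fejerBox_pos (N : ℕ) : (0 : ℝ) < (fejerBox N).card := by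
  rw [card_fejerBox]; positivity

/-- The Fourier coefficients of the `N`-th Fejér kernel of the torus. -/
noncomputable def fejerCoeff (N : ℕ) (α : ℕ →₀ ℤ) : ℝ :=
  ((fejerBox N ×ˢ fejerBox N).filter fun z => z.1 - z.2 = α).card / (fejerBox N).card

/-- The spectrum of the `N`-th Fejér kernel of the torus. -/
noncomputable def fejerSupport (N : ℕ) : Finset (ℕ →₀ ℤ) :=
  (fejerBox N ×ˢ fejerBox N).image fun z => z.1 - z.2

/-- The `N`-th Fejér kernel of the torus. -/
noncomputable def torusFejer (N : ℕ) (ω : InfTorus) : ℝ :=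
  ‖∑ β ∈ fejerBox N, torusMonomial β ω‖ ^ 2 / (fejerBox N).card

lemma fejerCoeff_of_notMem {N : ℕ} {α : ℕ →₀ ℤ} (hα : α ∉ fejerSupport N) :
    fejerCoeff N α = 0 := by
  rw [fejerCoeff, Finset.filter_eq_empty_iff.2, Finset.card_empty, Nat.cast_zero, zero_div]
  intro z hz h
  exact hα (Finset.mem_image.2 ⟨z, hz, h⟩)

lemma torusFejer_nonneg (N : ℕ) (ω : InfTorus) : 0 ≤ torusFejer N ω := by
  unfold torusFejer; positivity

/-- Expanding the squared modulus over pairs and grouping them by difference gives the spectrum of a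
kernel whose positivity is evident. -/
lemma ofReal_torusFejer (N : ℕ) (ω : InfTorus) :
    (torusFejer N ω : ℂ) = ∑ α ∈ fejerSupport N, (fejerCoeff N α : ℂ) * torusMonomial α ω := by
  have h1 : ∑ z ∈ fejerBox N ×ˢ fejerBox N, torusMonomial (z.1 - z.2) ω =
      ∑ α ∈ fejerSupport N, ((fejerBox N ×ˢ fejerBox N).filter fun z => z.1 - z.2 = α).card •
        torusMonomial α ω :=
    Finset.sum_comp (fun α => torusMonomial α ω) fun z : (ℕ →₀ ℤ) × (ℕ →₀ ℤ) => z.1 - z.2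
  have h2 : ∑ z ∈ fejerBox N ×ˢ fejerBox N, torusMonomial (z.1 - z.2) ω =
      ((‖∑ β ∈ fejerBox N, torusMonomial β ω‖ ^ 2 : ℝ) : ℂ) := by
    rw [Complex.ofReal_pow, ← Complex.mul_conj', map_sum, Finset.sum_mul_sum, Finset.sum_product]
    simp only [torusMonomial_sub_apply]
  rw [torusFejer, Complex.ofReal_div, ← h2, h1, Finset.sum_div]
  refine Finset.sum_congr rfl fun α _ => ?_
  rw [fejerCoeff, nsmul_eq_mul]
  push_cast
  ring

lemma fejerCoeff_zero (N : ℕ) : fejerCoeff N 0 = 1 := by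
  have h : ((fejerBox N ×ˢ fejerBox N).filter fun z => z.1 - z.2 = 0) = (fejerBox N).diag := by
    ext z
    simp only [Finset.mem_filter, Finset.mem_product, Finset.mem_diag, sub_eq_zero]
    constructor
    · rintro ⟨⟨h1, -⟩, h2⟩; exact ⟨h1, h2⟩
    · rintro ⟨h1, h2⟩; exact ⟨⟨h1, h2 ▸ h1⟩, h2⟩
  rw [fejerCoeff, h, Finset.diag_card, div_self (card_fejerBox_pos N).ne']

lemma zero_mem_fejerSupport (N : ℕ) : 0 ∈ fejerSupport N := by
  by_contra h
  have h1 := fejerCoeff_of_notMem h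
  rw [fejerCoeff_zero] at h1
  exact one_ne_zero h1

lemma continuous_torusFejer (N : ℕ) : Continuous (torusFejer N) := by
  have h (β : ℕ →₀ ℤ) : Continuous fun ω => torusMonomial β ω := (torusMonomial β).continuous
  unfold torusFejer
  exact ((continuous_finsetSum _ fun β _ => h β).norm.pow 2).div_const _

lemma integral_torusFejer (N : ℕ) : ∫ ω, torusFejer N ω ∂torusHaar = 1 := by
  have h : ∫ ω, (torusFejer N ω : ℂ) ∂torusHaar = 1 := by
    simp only [ofReal_torusFejer]
    rw [integral_finsetSum]
    · simp only [integral_const_mul, integral_torusMonomial, mul_ite, mul_one, mul_zero,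
        Finset.sum_ite_eq', zero_mem_fejerSupport, if_true, fejerCoeff_zero, Complex.ofReal_one]
    · intro α _
      exact ((torusMonomial α).continuous.integrable_of_hasCompactSupport
        (HasCompactSupport.of_compactSpace _)).const_mul _
  rw [integral_complex_ofReal] at h
  exact_mod_cast h

/-- The one-dimensional Fejér coefficient. -/
noncomputable def fejerCoeffOne (N : ℕ) (a : ℤ) : ℝ :=
  ((Finset.Ico 0 ((N : ℤ) + 1)).filter fun b => b + a ∈ Finset.Ico 0 ((N : ℤ) + 1)).card / (N + 1)

lemma fejerCoeffOne_zero (N : ℕ) : fejerCoeffOne N 0 = 1 := by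
  have h : ((Finset.Ico 0 ((N : ℤ) + 1)).filter fun b => b + 0 ∈ Finset.Ico 0 ((N : ℤ) + 1)) =
      Finset.Ico 0 ((N : ℤ) + 1) := by
    refine Finset.filter_true_of_mem fun b hb => by simpa using hb
  rw [fejerCoeffOne, h, Int.card_Ico]
  have : (((N : ℤ) + 1 - 0).toNat : ℝ) = N + 1 := by
    have : ((N : ℤ) + 1 - 0).toNat = N + 1 := by omega
    rw [this]; push_cast; ring
  rw [this, div_self (by positivity)]

lemma tendsto_fejerCoeffOne (a : ℤ) : Tendsto (fun N => fejerCoeffOne N a) atTop (𝓝 1) := by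
  have hlim : Tendsto (fun N : ℕ => 1 - |(a : ℝ)| * (1 / ((N : ℝ) + 1))) atTop (𝓝 1) := by
    simpa using (tendsto_one_div_add_atTop_nhds_zero_nat (𝕜 := ℝ)).const_mul (|(a : ℝ)|)
      |>.const_sub 1
  refine tendsto_of_tendsto_of_tendsto_of_le_of_le hlim tendsto_const_nhds (fun N => ?_) fun N => ?_
  -- The overlap of an interval of `N + 1` integers with its shift by `a` has at least `N + 1 - |a|`
  -- points.
  · have h1 : Finset.Ico (max 0 (-a)) (min ((N : ℤ) + 1) (N + 1 - a)) ⊆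
        (Finset.Ico 0 ((N : ℤ) + 1)).filter fun b => b + a ∈ Finset.Ico 0 ((N : ℤ) + 1) := by
      intro b hb
      simp only [Finset.mem_Ico, Finset.mem_filter] at hb ⊢
      omega
    have h2 := Finset.card_le_card h1
    rw [Int.card_Ico] at h2
    have h3 : (N : ℤ) + 1 - |a| ≤ (((Finset.Ico 0 ((N : ℤ) + 1)).filter
        fun b => b + a ∈ Finset.Ico 0 ((N : ℤ) + 1)).card : ℤ) := by
      rcases abs_cases a with h | h <;> omega
    have h4 : (N : ℝ) + 1 - |(a : ℝ)| ≤ (((Finset.Ico 0 ((N : ℤ) + 1)).filter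
        fun b => b + a ∈ Finset.Ico 0 ((N : ℤ) + 1)).card : ℝ) := by exact_mod_cast h3
    rw [fejerCoeffOne, le_div_iff₀ (by positivity)]
    refine le_of_eq_of_le ?_ h4
    field_simp
  · rw [fejerCoeffOne, div_le_one (by positivity)]
    have h1 := Finset.card_filter_le (Finset.Ico 0 ((N : ℤ) + 1))
      fun b => b + a ∈ Finset.Ico 0 ((N : ℤ) + 1)
    rw [Int.card_Ico] at h1
    have h2 : ((N : ℤ) + 1 - 0).toNat = N + 1 := by omega
    rw [h2] at h1
    have h3 := Nat.cast_le (α := ℝ).2 h1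
    rwa [Nat.cast_succ] at h3

/-- A pair with difference `α` is determined by its second entry, and the box condition splits over
coordinates; those outside the support contribute the factor 1. -/
lemma fejerCoeff_eq_prod {N : ℕ} {α : ℕ →₀ ℤ} (hα : α.support ⊆ Finset.range (N + 1)) :
    fejerCoeff N α = ∏ j ∈ α.support, fejerCoeffOne N (α j) := by
  have h1 : ((fejerBox N ×ˢ fejerBox N).filter fun z => z.1 - z.2 = α).card =
      ((Finset.range (N + 1)).finsupp fun j => (Finset.Ico 0 ((N : ℤ) + 1)).filter
        fun b => b + α j ∈ Finset.Ico 0 ((N : ℤ) + 1)).card := by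
    refine Finset.card_nbij' (fun z => z.2) (fun β => (β + α, β)) ?_ ?_ ?_ ?_
    · rintro ⟨β, γ⟩ h
      simp only [Finset.coe_filter, Finset.mem_product, Set.mem_ofPred_eq, fejerBox,
        Finset.mem_finsupp_iff, Finset.mem_coe, Finset.mem_filter] at h ⊢
      obtain ⟨⟨⟨-, h1⟩, h2, h3⟩, rfl⟩ := h
      refine ⟨h2, fun j hj => ⟨h3 j hj, ?_⟩⟩
      simpa using h1 j hj
    · intro β h
      simp only [Finset.coe_filter, Finset.mem_product, Set.mem_ofPred_eq, fejerBox,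
        Finset.mem_finsupp_iff, Finset.mem_coe, Finset.mem_filter] at h ⊢
      refine ⟨⟨⟨?_, fun j hj => (h.2 j hj).2⟩, h.1, fun j hj => (h.2 j hj).1⟩, by simp⟩
      exact Finsupp.support_add.trans (Finset.union_subset h.1 hα)
    · rintro ⟨β, γ⟩ h
      simp only [Finset.coe_filter, Set.mem_ofPred_eq] at h
      simp [← h.2]
    · intro β _; rfl
  rw [fejerCoeff, h1, Finset.card_finsupp, card_fejerBox,
    Finset.prod_subset hα fun j _ hj => by
      rw [Finsupp.notMem_support_iff.1 hj, fejerCoeffOne_zero]]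
  simp only [fejerCoeffOne, Finset.prod_div_distrib, Finset.prod_const, Finset.card_range]
  push_cast
  rfl

lemma tendsto_fejerCoeff (α : ℕ →₀ ℤ) : Tendsto (fun N => fejerCoeff N α) atTop (𝓝 1) := by
  have h : Tendsto (fun N => ∏ j ∈ α.support, fejerCoeffOne N (α j)) atTop (𝓝 1) := by
    simpa using tendsto_finsetProd α.support fun j _ => tendsto_fejerCoeffOne (α j)
  refine h.congr' ?_
  filter_upwards [eventually_ge_atTop (α.support.sup id)] with N hN
  refine (fejerCoeff_eq_prod fun j hj => ?_).symm
  rw [Finset.mem_range]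
  exact Nat.lt_succ_of_le ((Finset.le_sup (f := id) hj).trans hN)

end TorusFejer

/-! ## Integral form of the summing inequality -/

section Summing

open Filter Topology

variable {V W : Type*} [NormedAddCommGroup V] [NormedSpace ℝ V] [CompleteSpace V]
  [NormedAddCommGroup W] [NormedSpace ℝ W]

/-- The summing inequality on a cone `P` extends from finite sums to integrals. -/
lemma integral_norm_le_of_summing {Ω Y : Type*} [TopologicalSpace Ω] [CompactSpace Ω]
    [SecondCountableTopology Ω] [MeasurableSpace Ω] [BorelSpace Ω] {μ : Measure Ω}
    [IsFiniteMeasure μ] [NormedAddCommGroup Y] [NormedSpace ℝ Y] {C : ℝ} {P : Set V} (hP0 : 0 ∈ P)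
    (hP : ∀ r : ℝ, 0 ≤ r → ∀ v ∈ P, r • v ∈ P) (S : V →L[ℝ] Y) (J : V →L[ℝ] W)
    (hS : ∀ (A : Finset V) (w : V → V), (∀ v ∈ A, w v ∈ P) →
      ∑ v ∈ A, ‖S (w v)‖ ≤ C * ‖J (∑ v ∈ A, w v)‖)
    {G : Ω → V} (hG : Continuous G) (hGP : ∀ ω, G ω ∈ P) :
    ∫ ω, ‖S (G ω)‖ ∂μ ≤ C * ‖J (∫ ω, G ω ∂μ)‖ := by
  let _ : MeasurableSpace V := borel V
  have : BorelSpace V := ⟨rfl⟩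
  have hGi : Integrable G μ :=
    hG.integrable_of_hasCompactSupport (HasCompactSupport.of_compactSpace G)
  -- The simple approximations take values in the range of `G` or equal to the base point 0; both
  -- lie in `P`, so the approximations stay in the cone.
  have hsep : TopologicalSpace.IsSeparable (Set.range G ∪ {0}) :=
    (TopologicalSpace.isSeparable_range hG).union (Set.countable_singleton 0).isSeparable
  have : TopologicalSpace.SeparableSpace (Set.range G ∪ {0} : Set V) := hsep.separableSpace
  set s : ℕ → SimpleFunc Ω V := fun n =>
    SimpleFunc.approxOn G hG.measurable (Set.range G ∪ {0}) 0 (by simp) n with hs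
  have hsP (n : ℕ) (ω : Ω) : s n ω ∈ P := by
    have h := SimpleFunc.approxOn_mem hG.measurable (s := Set.range G ∪ {0}) (y₀ := 0) (by simp) n ω
    rcases h with ⟨ω', h⟩ | h
    · rw [show s n ω = G ω' from h.symm]; exact hGP ω'
    · rw [show s n ω = 0 from h]; exact hP0
  have hsi (n : ℕ) : Integrable (s n) μ := SimpleFunc.integrable_approxOn_range hG.measurable hGi n
  have h1 := tendsto_integral_norm_approxOn_sub hG.measurable hGi
  have h2 : Tendsto (fun n => ∫ ω, s n ω ∂μ) atTop (𝓝 (∫ ω, G ω ∂μ)) :=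
    tendsto_integral_of_L1 G hGi.1 (Eventually.of_forall hsi)
      (SimpleFunc.tendsto_approxOn_range_L1_enorm hG.measurable hGi)
  have hsimple (n : ℕ) : ∫ ω, ‖S (s n ω)‖ ∂μ ≤ C * ‖J (∫ ω, s n ω ∂μ)‖ := by
    have h3 : ∫ ω, ‖S (s n ω)‖ ∂μ = ∑ v ∈ (s n).range, ‖S (μ.real (s n ⁻¹' {v}) • v)‖ := by
      have h4 : Integrable ((s n).map fun v => ‖S v‖) μ := (S.integrable_comp (hsi n)).norm
      have h5 := SimpleFunc.map_integral (s n) (fun v => ‖S v‖) (hsi n) (by simp)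
      rw [SimpleFunc.integral_eq_integral _ h4] at h5
      refine Eq.trans ?_ (h5.trans (Finset.sum_congr rfl fun v _ => ?_))
      · rfl
      · rw [map_smul, norm_smul, Real.norm_of_nonneg measureReal_nonneg, smul_eq_mul]
    rw [h3, SimpleFunc.integral_eq_sum _ (hsi n)]
    -- The integral of a simple function is a finite sum whose weights, the measures of the fibres,
    -- are absorbed into the cone by homogeneity.
    refine hS _ (fun v => μ.real (s n ⁻¹' {v}) • v) fun v hv => hP _ measureReal_nonneg _ ?_
    obtain ⟨ω, rfl⟩ := SimpleFunc.mem_range.1 hv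
    exact hsP n ω
  have hle (n : ℕ) : ∫ ω, ‖S (G ω)‖ ∂μ ≤
      C * ‖J (∫ ω, s n ω ∂μ)‖ + ‖S‖ * ∫ ω, ‖s n ω - G ω‖ ∂μ := by
    refine le_trans ?_ (add_le_add_left (hsimple n) _)
    rw [← integral_const_mul, ← integral_add]
    · refine integral_mono (S.integrable_comp hGi).norm ?_ fun ω => ?_
      · exact (S.integrable_comp (hsi n)).norm.add (((hsi n).sub hGi).norm.const_mul _)
      · have h3 := S.le_opNorm (s n ω - G ω)
        rw [map_sub] at h3
        have h4 := norm_sub_norm_le (S (G ω)) (S (s n ω))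
        rw [norm_sub_rev] at h4
        simp only
        linarith
    · exact (S.integrable_comp (hsi n)).norm
    · exact ((hsi n).sub hGi).norm.const_mul _
  have h3 : Tendsto (fun n => C * ‖J (∫ ω, s n ω ∂μ)‖ + ‖S‖ * ∫ ω, ‖s n ω - G ω‖ ∂μ) atTop
      (𝓝 (C * ‖J (∫ ω, G ω ∂μ)‖ + ‖S‖ * 0)) :=
    ((((J.continuous.tendsto _).comp h2).norm).const_mul C).add (h1.const_mul _)
  rw [mul_zero, add_zero] at h3
  exact ge_of_tendsto' h3 hle

end Summing

/-! ## Fejér means of operators on continuous functions -/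

section FejerMean

open Filter Topology

variable {W : Type*} [NormedAddCommGroup W] [NormedSpace ℂ W] [CompleteSpace W]

/-- The `N`-th Fejér mean `∑ k_N(α) S(ω^{-α}) ω^α` of an operator `S` on continuous functions. -/
noncomputable def fejerMean (N : ℕ) (S : C(InfTorus, ℂ) →L[ℂ] X) : C(InfTorus, X) :=
  ∑ α ∈ fejerSupport N, monomialVec α ((fejerCoeff N α : ℂ) • S (torusMonomial (-α)))

/-- The function `ω ↦ K_N(ω ·⁻¹)` with values in the continuous functions. -/
noncomputable def fejerTranslate (N : ℕ) (ω : InfTorus) : C(InfTorus, ℂ) :=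
  ∑ α ∈ fejerSupport N, ((fejerCoeff N α : ℂ) * torusMonomial α ω) • torusMonomial (-α)

lemma fejerTranslate_apply (N : ℕ) (ω y : InfTorus) :
    fejerTranslate N ω y = torusFejer N (ω * y⁻¹) := by
  rw [ofReal_torusFejer, fejerTranslate, ContinuousMap.sum_apply]
  refine Finset.sum_congr rfl fun α _ => ?_
  rw [ContinuousMap.smul_apply, torusMonomial_apply_mul, torusMonomial_apply_inv, smul_eq_mul,
    mul_assoc]

/-- Point values of the mean are values of `S` at positive functions, which is how the summing
inequality reaches its pointwise norms. -/
lemma map_fejerTranslate (N : ℕ) (S : C(InfTorus, ℂ) →L[ℂ] X) (ω : InfTorus) :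
    S (fejerTranslate N ω) = fejerMean N S ω := by
  rw [fejerTranslate, fejerMean, map_sum, ContinuousMap.sum_apply]
  refine Finset.sum_congr rfl fun α _ => ?_
  rw [map_smul, monomialVec_apply, smul_smul, mul_comm]

lemma continuous_fejerTranslate (N : ℕ) : Continuous (fejerTranslate N) :=
  continuous_finsetSum _ fun α _ =>
    (continuous_const.mul (torusMonomial α).continuous).smul continuous_const

/-- A real-valued continuous function, seen as a complex-valued one. -/
noncomputable def complexify (h : C(InfTorus, ℝ)) : C(InfTorus, ℂ) :=
  ⟨fun ω => (h ω : ℂ), Complex.continuous_ofReal.comp h.continuous⟩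

lemma complexify_apply (h : C(InfTorus, ℝ)) (ω : InfTorus) : complexify h ω = h ω := rfl

lemma integrable_torusHaar_of_continuous {Y : Type*} [NormedAddCommGroup Y] {f : InfTorus → Y}
    (hf : Continuous f) : Integrable f torusHaar :=
  hf.integrable_of_hasCompactSupport (HasCompactSupport.of_compactSpace f)

/-- At each point `y` the substitution `ω = u y` exchanges translates of the kernel for translates
of `h`, whose norms under `J` are controlled. -/
lemma integral_smul_fejerTranslate (N : ℕ) (h : C(InfTorus, ℝ)) :
    ∫ ω, h ω • fejerTranslate N ω ∂torusHaar =
      ∫ u, torusFejer N u • torusTranslate u (complexify h) ∂torusHaar := by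
  have h1 : Continuous fun ω => h ω • fejerTranslate N ω :=
    h.continuous.smul (continuous_fejerTranslate N)
  have h2 : Continuous fun u => torusFejer N u • torusTranslate u (complexify h) :=
    (continuous_torusFejer N).smul (continuous_torusTranslate _)
  ext y
  have e1 := (ContinuousMap.evalCLM ℝ y).integral_comp_comm
    (integrable_torusHaar_of_continuous h1)
  have e2 := (ContinuousMap.evalCLM ℝ y).integral_comp_comm
    (integrable_torusHaar_of_continuous h2)
  simp only [ContinuousMap.evalCLM_apply] at e1 e2
  rw [← e1, ← e2, ← integral_mul_right_eq_self _ y]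
  refine integral_congr_ae (Eventually.of_forall fun u => ?_)
  simp only [ContinuousMap.smul_apply, fejerTranslate_apply, mul_inv_cancel_right,
    torusTranslate_apply, complexify_apply, Complex.real_smul]
  rw [mul_comm u y, mul_comm]

/-- The Fejér means of an operator satisfying the summing inequality with respect to `‖J ·‖`. -/
lemma integral_norm_fejerMean_mul_le {C : ℝ} (hC : 0 ≤ C) (S : C(InfTorus, ℂ) →L[ℂ] X)
    (J : C(InfTorus, ℂ) →L[ℂ] W)
    (hS : ∀ (A : Finset C(InfTorus, ℂ)) (w : C(InfTorus, ℂ) → C(InfTorus, ℂ)),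
      (∀ v ∈ A, 0 ≤ w v) → ∑ v ∈ A, ‖S (w v)‖ ≤ C * ‖J (∑ v ∈ A, w v)‖)
    (hJ : ∀ u f, ‖J (torusTranslate u f)‖ ≤ ‖J f‖) (N : ℕ) (h : C(InfTorus, ℝ))
    (hh : ∀ ω, 0 ≤ h ω) :
    ∫ ω, h ω * ‖fejerMean N S ω‖ ∂torusHaar ≤ C * ‖J (complexify h)‖ := by
  have h1 : Continuous fun ω => h ω • fejerTranslate N ω :=
    h.continuous.smul (continuous_fejerTranslate N)
  have h2 : Continuous fun u => torusFejer N u • torusTranslate u (complexify h) :=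
    (continuous_torusFejer N).smul (continuous_torusTranslate _)
  have key := integral_norm_le_of_summing (μ := torusHaar) (P := {v : C(InfTorus, ℂ) | 0 ≤ v})
    (C := C) (by simp) (fun r hr v hv => ?_) (S.restrictScalars ℝ) (J.restrictScalars ℝ)
    hS h1 (fun ω => ?_)
  · have h3 (ω : InfTorus) : ‖S.restrictScalars ℝ (h ω • fejerTranslate N ω)‖ =
        h ω * ‖fejerMean N S ω‖ := by
      rw [map_smul, norm_smul, Real.norm_of_nonneg (hh ω), ContinuousLinearMap.coe_restrictScalars',
        map_fejerTranslate]
    simp only [h3] at key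
    refine key.trans (mul_le_mul_of_nonneg_left ?_ hC)
    rw [integral_smul_fejerTranslate, ← ContinuousLinearMap.integral_comp_comm _
      (integrable_torusHaar_of_continuous h2)]
    calc _ ≤ ∫ u, torusFejer N u * ‖J (complexify h)‖ ∂torusHaar := by
          refine norm_integral_le_of_norm_le ((integrable_torusHaar_of_continuous
            (continuous_torusFejer N)).mul_const _) (Eventually.of_forall fun u => ?_)
          rw [map_smul, norm_smul, Real.norm_of_nonneg (torusFejer_nonneg N u)]
          exact mul_le_mul_of_nonneg_left (hJ u _) (torusFejer_nonneg N u)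
      _ = _ := by rw [integral_mul_const, integral_torusFejer, one_mul]
  · rw [Set.mem_ofPred_eq] at hv ⊢
    intro y
    change (0 : ℂ) ≤ r • v y
    rw [Complex.real_smul]
    exact mul_nonneg (Complex.zero_le_real.2 hr) (hv y)
  · rw [Set.mem_ofPred_eq]
    intro y
    change (0 : ℂ) ≤ h ω • fejerTranslate N ω y
    rw [Complex.real_smul, fejerTranslate_apply]
    exact mul_nonneg (Complex.zero_le_real.2 (hh ω)) (Complex.zero_le_real.2 (torusFejer_nonneg N _))

end FejerMean

/-! ## Detecting `L_p` norms by duality with nonnegative continuous functions -/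

section Dual

open Filter Topology

lemma norm_toLp_eq_integral_rpow {p : ℝ≥0∞} [Fact (1 ≤ p)] (hp : p ≠ ∞) (f : C(InfTorus, X)) :
    ‖ContinuousMap.toLp p torusHaar ℂ f‖ =
      (∫ ω, ‖f ω‖ ^ p.toReal ∂torusHaar) ^ (p.toReal)⁻¹ := by
  have hp0 : p ≠ 0 := (zero_lt_one.trans_le (Fact.out : 1 ≤ p)).ne'
  rw [Lp.norm_def, eLpNorm_congr_ae (ContinuousMap.coeFn_toLp _ _),
    (ContinuousMap.memLp (p := p) torusHaar ℂ f).eLpNorm_eq_integral_rpow_norm hp0 hp,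
    ENNReal.toReal_ofReal]
  positivity

/-- The test function 1 suffices. -/
lemma norm_toLp_one_le_of_duality {f : C(InfTorus, X)} {C : ℝ} (hC : 0 ≤ C)
    (h : ∀ h : C(InfTorus, ℝ), (∀ ω, 0 ≤ h ω) →
      ∫ ω, h ω * ‖f ω‖ ∂torusHaar ≤ C * ‖complexify h‖) :
    ‖ContinuousMap.toLp 1 torusHaar ℂ f‖ ≤ C := by
  have h1 := h 1 fun ω => zero_le_one
  have h2 : ‖complexify 1‖ ≤ 1 := by
    refine (ContinuousMap.norm_le _ zero_le_one).2 fun ω => ?_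
    simp [complexify_apply]
  rw [norm_toLp_eq_integral_rpow ENNReal.one_ne_top]
  simp only [ENNReal.toReal_one, Real.rpow_one, inv_one]
  refine le_trans ?_ (h1.trans (mul_le_of_le_one_right hC h2))
  simp

/-- Tested on the excess `k = (‖f‖ - C)₊`, the hypothesis becomes `∫ k² ≤ 0`, because `k ‖f‖ - C k =
k²`. -/
lemma norm_toLp_top_le_of_duality {f : C(InfTorus, X)} {C : ℝ} (hC : 0 ≤ C)
    (h : ∀ h : C(InfTorus, ℝ), (∀ ω, 0 ≤ h ω) →
      ∫ ω, h ω * ‖f ω‖ ∂torusHaar ≤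
        C * ‖ContinuousMap.toLp (E := ℂ) 1 torusHaar ℂ (complexify h)‖) :
    ‖ContinuousMap.toLp ∞ torusHaar ℂ f‖ ≤ C := by
  let k : C(InfTorus, ℝ) := ⟨fun ω => max (‖f ω‖ - C) 0, by fun_prop⟩
  have hk (ω : InfTorus) : 0 ≤ k ω := le_max_right _ _
  have h1 := h k hk
  rw [norm_toLp_eq_integral_rpow ENNReal.one_ne_top] at h1
  simp only [ENNReal.toReal_one, Real.rpow_one, inv_one, complexify_apply, Complex.norm_real,
    Real.norm_of_nonneg (hk _)] at h1
  rw [← integral_const_mul, ← sub_nonpos, ← integral_sub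
    (integrable_torusHaar_of_continuous (by fun_prop))
    (integrable_torusHaar_of_continuous (by fun_prop))] at h1
  have h2 (ω : InfTorus) : k ω * ‖f ω‖ - C * k ω = k ω ^ 2 := by
    rcases le_total (‖f ω‖ - C) 0 with h | h
    · have : k ω = 0 := max_eq_right h
      rw [this]; ring
    · have : k ω = ‖f ω‖ - C := max_eq_left h
      rw [this]; ring
  simp only [h2] at h1
  have h3 : (fun ω => k ω ^ 2) =ᵐ[torusHaar] 0 :=
    (integral_eq_zero_iff_of_nonneg (fun ω => sq_nonneg _)
      (integrable_torusHaar_of_continuous (k.continuous.pow 2))).1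
      (le_antisymm h1 (integral_nonneg fun ω => sq_nonneg _))
  have h4 : ∀ᵐ ω ∂torusHaar, ‖ContinuousMap.toLp ∞ torusHaar ℂ f ω‖ ≤ C := by
    filter_upwards [h3, ContinuousMap.coeFn_toLp (𝕜 := ℂ) (p := ∞) torusHaar f] with ω h5 h6
    rw [h6]
    have h7 : k ω = 0 := by simpa using h5
    have h8 : ‖f ω‖ - C ≤ k ω := le_max_left _ _
    linarith
  simpa using Lp.norm_le_of_ae_bound hC h4

/-- For finite `p` the test function is the equality case of Hölder, `k = ‖f‖^(p-1)`, with `k^q = k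
‖f‖ = ‖f‖^p`; it is continuous since `p > 1`. -/
lemma norm_toLp_le_of_duality {p q : ℝ≥0∞} [Fact (1 ≤ p)] [Fact (1 ≤ q)]
    [hpq : ENNReal.HolderConjugate p q] (hp : 1 < p) {f : C(InfTorus, X)} {C : ℝ} (hC : 0 ≤ C)
    (h : ∀ h : C(InfTorus, ℝ), (∀ ω, 0 ≤ h ω) →
      ∫ ω, h ω * ‖f ω‖ ∂torusHaar ≤
        C * ‖ContinuousMap.toLp (E := ℂ) q torusHaar ℂ (complexify h)‖) :
    ‖ContinuousMap.toLp p torusHaar ℂ f‖ ≤ C := by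
  rcases eq_or_ne p ∞ with rfl | hpt
  · obtain rfl : q = 1 := (ENNReal.HolderConjugate.eq_top_iff_eq_one ∞ q).1 rfl
    exact norm_toLp_top_le_of_duality hC h
  have hqt : q ≠ ∞ := (ENNReal.HolderConjugate.lt_top_iff_one_lt q p).2 hp |>.ne
  have hP : 1 < p.toReal := by
    rw [← ENNReal.toReal_one]; exact (ENNReal.toReal_lt_toReal ENNReal.one_ne_top hpt).2 hp
  have hPQ : p.toReal.HolderConjugate q.toReal := by
    have := ENNReal.HolderConjugate.toReal_of_ne_top (p := p) (q := q) hpt hqt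
    exact this
  let k : C(InfTorus, ℝ) := ⟨fun ω => ‖f ω‖ ^ (p.toReal - 1),
    f.continuous.norm.rpow_const fun _ => Or.inr (by linarith)⟩
  have hk (ω : InfTorus) : 0 ≤ k ω := Real.rpow_nonneg (norm_nonneg _) _
  have h1 := h k hk
  rw [norm_toLp_eq_integral_rpow hqt] at h1
  simp only [complexify_apply, Complex.norm_real, Real.norm_of_nonneg (hk _)] at h1
  have h2 (ω : InfTorus) : k ω ^ q.toReal = ‖f ω‖ ^ p.toReal := by
    change (‖f ω‖ ^ (p.toReal - 1)) ^ q.toReal = _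
    rw [← Real.rpow_mul (norm_nonneg _), hPQ.sub_one_mul_conj]
  have h3 (ω : InfTorus) : k ω * ‖f ω‖ = ‖f ω‖ ^ p.toReal := by
    change ‖f ω‖ ^ (p.toReal - 1) * ‖f ω‖ = _
    rcases eq_or_ne ‖f ω‖ 0 with h0 | h0
    · rw [h0, mul_zero, Real.zero_rpow (by linarith)]
    · rw [Real.rpow_sub_one h0, div_mul_cancel₀ _ h0]
  simp only [h2, h3] at h1
  rw [norm_toLp_eq_integral_rpow hpt]
  set a := ∫ ω, ‖f ω‖ ^ p.toReal ∂torusHaar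
  have ha : 0 ≤ a := integral_nonneg fun ω => Real.rpow_nonneg (norm_nonneg _) _
  rcases ha.eq_or_lt with h0 | h0
  · rw [← h0, Real.zero_rpow (inv_ne_zero (by linarith))]; exact hC
  -- With `a = ∫ ‖f‖^p > 0`, dividing `a ≤ C a^(1/q)` by `a^(1/q)` leaves `a^(1/p) ≤ C`.
  · have h4 : p.toReal⁻¹ = 1 - q.toReal⁻¹ := by linarith [hPQ.inv_add_inv_eq_one]
    rw [h4, Real.rpow_sub h0, Real.rpow_one, div_le_iff₀ (Real.rpow_pos_of_pos h0 _)]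
    exact h1

end Dual

/-! ## Cone absolutely summing operators and suprema over the dual ball -/

section ConeSup

variable {E : Type*} [NormedAddCommGroup E] [NormedSpace ℂ E]

/-- A norming functional of the sum (Hahn–Banach) is one competitor in the supremum. -/
lemma norm_sum_le_iSup_dualBall {n : ℕ} (g : Fin n → E) :
    ‖∑ i, g i‖ ≤ ⨆ ξ : Metric.closedBall (0 : StrongDual ℂ E) 1, ∑ i, ‖ξ.1 (g i)‖ := by
  obtain ⟨ξ, hξ, h⟩ := exists_dual_vector'' ℂ (∑ i, g i)
  -- A real supremum of an unbounded family defaults to 0, so boundedness must be supplied.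
  have hbdd : BddAbove (Set.range fun ξ : Metric.closedBall (0 : StrongDual ℂ E) 1 =>
      ∑ i, ‖ξ.1 (g i)‖) := by
    refine ⟨∑ i, ‖g i‖, ?_⟩
    rintro _ ⟨ζ, rfl⟩
    refine Finset.sum_le_sum fun i _ => ?_
    have h1 : ‖ζ.1‖ ≤ 1 := mem_closedBall_zero_iff.1 ζ.2
    simpa using ζ.1.le_of_opNorm_le h1 (g i)
  refine le_trans ?_ (le_ciSup hbdd ⟨ξ, by simpa using hξ⟩)
  have h2 : ‖ξ (∑ i, g i)‖ = ‖∑ i, g i‖ := by rw [h]; simp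
  rw [← h2, map_sum]
  exact norm_sum_le _ _

/-- Phases `c_i` make every `c_i ξ (J w_i)` nonnegative, so the sum of moduli is `ξ` at `J (∑ c_i
w_i)`; positivity of the `w_i` gives `|∑ c_i w_i| ≤ ∑ w_i` pointwise. -/
lemma iSup_dualBall_le {n : ℕ} (J : C(InfTorus, ℂ) →L[ℂ] E)
    (hJ : ∀ u v : C(InfTorus, ℂ), (∀ ω, ‖u ω‖ ≤ ‖v ω‖) → ‖J u‖ ≤ ‖J v‖)
    (w : Fin n → C(InfTorus, ℂ)) (hw : ∀ i, 0 ≤ w i) :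
    ⨆ ξ : Metric.closedBall (0 : StrongDual ℂ E) 1, ∑ i, ‖ξ.1 (J (w i))‖ ≤ ‖J (∑ i, w i)‖ := by
  have : Nonempty (Metric.closedBall (0 : StrongDual ℂ E) 1) :=
    ⟨⟨0, Metric.mem_closedBall_self zero_le_one⟩⟩
  refine ciSup_le fun ξ => ?_
  have hphase (z : ℂ) : ∃ c : ℂ, ‖c‖ ≤ 1 ∧ c * z = ‖z‖ := by
    rcases eq_or_ne z 0 with rfl | hz
    · exact ⟨0, by simp, by simp⟩
    · refine ⟨‖z‖ / z, ?_, div_mul_cancel₀ _ hz⟩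
      rw [norm_div, Complex.norm_real, norm_norm, div_self (norm_ne_zero_iff.2 hz)]
  choose c hc1 hc using fun i => hphase (ξ.1 (J (w i)))
  have h1 : ξ.1 (J (∑ i, c i • w i)) = ((∑ i, ‖ξ.1 (J (w i))‖ : ℝ) : ℂ) := by
    simp only [map_sum, map_smul, smul_eq_mul, hc, Complex.ofReal_sum]
  have h2 : ‖J (∑ i, c i • w i)‖ ≤ ‖J (∑ i, w i)‖ := by
    refine hJ _ _ fun ω => ?_
    simp only [ContinuousMap.sum_apply, ContinuousMap.smul_apply, smul_eq_mul]
    have h3 (i) : w i ω = (‖w i ω‖ : ℂ) := Complex.eq_coe_norm_of_nonneg (hw i ω)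
    calc _ ≤ ∑ i, ‖w i ω‖ := by
          refine (norm_sum_le _ _).trans (Finset.sum_le_sum fun i _ => ?_)
          rw [norm_mul]
          exact mul_le_of_le_one_left (norm_nonneg _) (hc1 i)
      _ = _ := by
          rw [Finset.sum_congr rfl fun i _ => h3 i, ← Complex.ofReal_sum, Complex.norm_real,
            Real.norm_of_nonneg (Finset.sum_nonneg fun i _ => norm_nonneg _)]
  have h3 : ‖ξ.1‖ ≤ 1 := mem_closedBall_zero_iff.1 ξ.2
  have h4 := ξ.1.le_of_opNorm_le h3 (J (∑ i, c i • w i))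
  rw [h1, Complex.norm_real, Real.norm_of_nonneg (Finset.sum_nonneg fun i _ => norm_nonneg _),
    one_mul] at h4
  exact h4.trans h2

/-- The summing inequality of `T`, pulled back to finite sets of nonnegative continuous functions. -/
lemma ConeSummingWith.sum_norm_le [PartialOrder E] {C : ℝ} (hC : 0 ≤ C) {T : E →L[ℂ] X}
    (hT : ConeSummingWith C T) (J : C(InfTorus, ℂ) →L[ℂ] E) (hJ0 : ∀ f, 0 ≤ f → 0 ≤ J f)
    (hJ : ∀ u v : C(InfTorus, ℂ), (∀ ω, ‖u ω‖ ≤ ‖v ω‖) → ‖J u‖ ≤ ‖J v‖)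
    (A : Finset C(InfTorus, ℂ)) (w : C(InfTorus, ℂ) → C(InfTorus, ℂ)) (hw : ∀ v ∈ A, 0 ≤ w v) :
    ∑ v ∈ A, ‖T (J (w v))‖ ≤ C * ‖J (∑ v ∈ A, w v)‖ := by
  let e := A.equivFin.symm
  have hsum {M : Type _} [AddCommMonoid M] (F : C(InfTorus, ℂ) → M) :
      ∑ v ∈ A, F v = ∑ i, F (e i) := by
    rw [← Finset.sum_coe_sort A F]
    exact (Equiv.sum_comp e fun v => F v).symm
  rw [hsum, hsum]
  have hw' (i) : 0 ≤ w (e i) := hw _ (e i).2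
  exact (hT _ (fun i => J (w (e i))) fun i => hJ0 _ (hw' i)).trans
    (mul_le_mul_of_nonneg_left (iSup_dualBall_le J hJ _ hw') hC)

end ConeSup

/-! ## The Bohr transform on cone absolutely summing operators -/

section BohrTransform

open Filter Topology

variable {E : Type*} [NormedAddCommGroup E] [NormedSpace ℂ E] [PartialOrder E]

variable (X) in
/-- A function space `E` on the torus (with `J` the inclusion of the continuous functions into `E`
and `I` that of `E` into `L_q`) that is in duality with `L_p(𝕋^ℕ, X)`. -/
structure TorusDuality (p q : ℝ≥0∞) [Fact (1 ≤ p)] [Fact (1 ≤ q)] (J : C(InfTorus, ℂ) →L[ℂ] E)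
    (I : E →L[ℂ] Lp ℂ q torusHaar) : Prop where
  comp_eq : ∀ f, I (J f) = ContinuousMap.toLp q torusHaar ℂ f
  norm_le : ∀ g, ‖I g‖ ≤ ‖g‖
  nonneg : ∀ g, 0 ≤ g → 0 ≤ I g
  map_nonneg : ∀ f, 0 ≤ f → 0 ≤ J f
  mono : ∀ u v : C(InfTorus, ℂ), (∀ ω, ‖u ω‖ ≤ ‖v ω‖) → ‖J u‖ ≤ ‖J v‖
  translate_le : ∀ u f, ‖J (torusTranslate u f)‖ ≤ ‖J f‖
  dense : DenseRange J
  norm_le_of_duality : ∀ (f : C(InfTorus, X)) (C : ℝ), 0 ≤ C →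
    (∀ h : C(InfTorus, ℝ), (∀ ω, 0 ≤ h ω) →
      ∫ ω, h ω * ‖f ω‖ ∂torusHaar ≤ C * ‖J (complexify h)‖) →
    ‖ContinuousMap.toLp p torusHaar ℂ f‖ ≤ C

lemma dirichletSeries_ext {Y : Type*} {D D' : DirichletSeries Y}
    (h : ∀ α, D (primePow α) = D' (primePow α)) :
    D = D' := by
  ext n
  obtain ⟨α, rfl⟩ := primePowEquiv.surjective n
  exact h α

lemma torusToDirichlet_primePow {p : ℝ≥0∞} [Fact (1 ≤ p)] (f : Lp X p torusHaar) (α : ℕ →₀ ℕ) :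
    torusToDirichlet p f (primePow α) = torusFourierCoeff p (natIndex α) f :=
  bohrTransform_primePow (fun α => torusFourierCoeff p (natIndex α) f) α

/-- Since `log n ≥ 0`, the factor `n^{-ε}` is the damping `exp (-ε |l|)` produced by the mixture of
triangles. -/
lemma dirichletTranslate_apply_primePow (ε : ℝ) (D : DirichletSeries X) (α : ℕ →₀ ℕ) :
    dirichletTranslate (ε : ℂ) D (primePow α) =
      (Real.exp (-ε * |logWeight (natIndex α)|) : ℂ) • D (primePow α) := by
  have hpos : (0 : ℝ) < (primePow α : ℕ) := by exact_mod_cast (primePow α).pos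
  have h : (((primePow α : ℕ) : ℂ) ^ (ε : ℂ))⁻¹ =
      (Real.exp (-ε * |logWeight (natIndex α)|) : ℂ) := by
    rw [abs_of_nonneg (logWeight_natIndex_nonneg α), logWeight_natIndex, ← Complex.ofReal_natCast,
      ← Complex.ofReal_cpow hpos.le, ← Complex.ofReal_inv, Real.rpow_def_of_pos hpos,
      ← Real.exp_neg]
    congr 2
    ring
  change (((primePow α : ℕ) : ℂ) ^ (ε : ℂ))⁻¹ • D (primePow α) = _
  rw [h]

omit [PartialOrder E] in
/-- For uniformly bounded operators, the vectors at which they form a Cauchy sequence form a closed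
subspace. -/
lemma exists_isClosed_submodule_cauchySeq (T : ℕ → E →L[ℂ] X) {B : ℝ}
    (hB : ∀ k g, ‖T k g‖ ≤ B * ‖g‖) :
    ∃ Z : Submodule ℂ E, IsClosed (Z : Set E) ∧ ∀ g, g ∈ Z ↔ CauchySeq fun k => T k g := by
  wlog hB0 : 0 < B generalizing B
  · exact this (B := 1) (fun k g => (hB k g).trans (by nlinarith [norm_nonneg g])) one_pos
  let Z : Submodule ℂ E :=
    { carrier := {g | CauchySeq fun k => T k g}
      add_mem' := fun {g g'} hg hg' => by
        simp only [Set.mem_ofPred_eq, map_add] at hg hg' ⊢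
        exact CauchySeq.add hg hg'
      zero_mem' := by
        simpa only [Set.mem_ofPred_eq, map_zero] using cauchySeq_const (0 : X)
      smul_mem' := fun c g hg => by
        simp only [Set.mem_ofPred_eq, map_smul] at hg ⊢
        exact (uniformContinuous_const_smul c).comp_cauchySeq hg }
  have hZclosed : IsClosed (Z : Set E) := by
    refine isClosed_of_closure_subset fun g hg => ?_
    change CauchySeq fun k => T k g
    rw [Metric.cauchySeq_iff']
    intro δ hδ
    obtain ⟨g', hg', hgg'⟩ := Metric.mem_closure_iff.1 hg (δ / (3 * B)) (by positivity)
    have hclose (k : ℕ) : dist (T k g) (T k g') < δ / 3 := by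
      rw [dist_eq_norm, ← map_sub]
      refine (hB k _).trans_lt ?_
      rw [← dist_eq_norm]
      calc B * dist g g' < B * (δ / (3 * B)) := mul_lt_mul_of_pos_left hgg' hB0
        _ = δ / 3 := by field_simp
    have hg'' : CauchySeq fun k => T k g' := hg'
    obtain ⟨N, hN⟩ := Metric.cauchySeq_iff'.1 hg'' (δ / 3) (by positivity)
    refine ⟨N, fun n hn => ?_⟩
    have h1 := hclose n
    have h2 := hN n hn
    have h3 := hclose N
    rw [dist_comm] at h3
    linarith [dist_triangle4 (T n g) (T n g') (T N g') (T N g)]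
  exact ⟨Z, hZclosed, fun g => Iff.rfl⟩

variable {p q : ℝ≥0∞} [Fact (1 ≤ p)] [Fact (1 ≤ q)]
  {J : C(InfTorus, ℂ) →L[ℂ] E} {I : E →L[ℂ] Lp ℂ q torusHaar}

/-- A closed subspace containing all monomials is everything. -/
lemma TorusDuality.eq_top (hd : TorusDuality X p q J I) (Z : Submodule ℂ E)
    (hZ : IsClosed (Z : Set E)) (h : ∀ α, J (torusMonomial α) ∈ Z) : Z = ⊤ := by
  have h1 : Submodule.span ℂ (Set.range torusMonomial) ≤ Z.comap J.toLinearMap := by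
    rw [Submodule.span_le]
    rintro _ ⟨α, rfl⟩
    exact h α
  have h2 := Submodule.topologicalClosure_minimal _ h1 (hZ.preimage J.continuous)
  rw [span_torusMonomial_closure_eq_top] at h2
  rw [← top_le_iff]
  intro g _
  have h3 : Set.range J ⊆ (Z : Set E) := by
    rintro _ ⟨f, rfl⟩
    exact h2 (Submodule.mem_top (x := f))
  exact closure_minimal h3 hZ (hd.dense g)

variable [CompleteSpace E] [CompleteSpace X] [ENNReal.HolderConjugate p q]

/-- The translates of the Dirichlet series of an operator in `Λ⁺` belong to `ℋ_p`. -/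
lemma TorusDuality.exists_hardyTorus (hd : TorusDuality X p q J I) {T : E →L[ℂ] X}
    (hT0 : ∀ α : ℕ →₀ ℤ, (∃ j, α j < 0) → T (J (torusMonomial (-α))) = 0) {C : ℝ} (hC : 0 ≤ C)
    (hT : ConeSummingWith C T) {ε : ℝ} (hε : 0 < ε) :
    ∃ g ∈ hardyTorus X p, ‖g‖ ≤ C ∧ torusToDirichlet p g = dirichletTranslate (ε : ℂ)
      (bohrTransform fun α => T (J (torusMonomial (-natIndex α)))) := by
  set S : C(InfTorus, ℂ) →L[ℂ] X := T.comp J with hS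
  set x : (ℕ →₀ ℤ) → X := fun α => S (torusMonomial (-α)) with hx
  have hmean (N : ℕ) : ‖∑ α ∈ fejerSupport N, (fejerCoeff N α : ℂ) • monomialLp p α (x α)‖ ≤ C := by
    have h1 := hd.norm_le_of_duality (fejerMean N S) C hC fun h hh =>
      integral_norm_fejerMean_mul_le hC S J
        (hT.sum_norm_le hC J hd.map_nonneg hd.mono) hd.translate_le N h hh
    rw [fejerMean, map_sum] at h1
    refine le_of_eq_of_le (congrArg _ (Finset.sum_congr rfl fun α _ => ?_)) h1
    rw [← monomialLp_smul, monomialLp]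
  obtain ⟨g, hgC, hg⟩ := exists_tendsto_sum_exp_smul (C := C) hε logWeight
    (fun α => monomialLp p α (x α)) fejerSupport (fun N α => (fejerCoeff N α : ℂ))
    (fun N α hα => by rw [fejerCoeff_of_notMem hα, Complex.ofReal_zero])
    (fun α => by
      have := (Complex.continuous_ofReal.tendsto _).comp (tendsto_fejerCoeff α)
      simpa [Function.comp_def] using this)
    -- The vanishing of `T` at indices with a negative entry is what leaves finitely many terms of
    -- bounded frequency: over all integer exponents, frequencies accumulate.
    (fun r => (finite_setOf_logWeight_lt r).subset fun α hα => ⟨fun hneg => hα.1 (by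
      simp only [hx, hS]
      rw [ContinuousLinearMap.comp_apply, hT0 α hneg, monomialLp_zero]), hα.2⟩)
    (fun N R _ => by
      have h1 := norm_sum_triangle_smul_monomialLp_le p R (fejerSupport N)
        fun α => (fejerCoeff N α : ℂ) • x α
      simp only [monomialLp_smul] at h1
      exact h1.trans (hmean N))
  -- Fourier coefficients are continuous on `L_p`, so they pass to the limit, and the Fejér factor
  -- at `β` tends to 1.
  have hcoeff (β : ℕ →₀ ℤ) :
      torusFourierCoeff p β g = (Real.exp (-ε * |logWeight β|) : ℂ) • x β := by
    have h1 : Tendsto (fun N => torusFourierCoeff p β (∑ α ∈ fejerSupport N,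
        (Real.exp (-ε * |logWeight α|) : ℂ) • (fejerCoeff N α : ℂ) • monomialLp p α (x α)))
        atTop (𝓝 (torusFourierCoeff p β g)) := by
      have h2 : Continuous fun f : Lp X p torusHaar => torusFourierCoeff p β f := by
        have h3 (f : Lp X p torusHaar) :
            torusFourierCoeff p β f = torusPairing p q f (lpMonomial q (-β)) := by
          rw [torusPairing_lpMonomial, neg_neg]
        simp only [h3]
        exact (torusPairing p q).continuous.clm_apply continuous_const
      exact (h2.tendsto g).comp hg
    have h2 (N : ℕ) : torusFourierCoeff p β (∑ α ∈ fejerSupport N,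
        (Real.exp (-ε * |logWeight α|) : ℂ) • (fejerCoeff N α : ℂ) • monomialLp p α (x α)) =
        (Real.exp (-ε * |logWeight β|) : ℂ) • (fejerCoeff N β : ℂ) • x β := by
      simp only [map_sum, map_smul, torusFourierCoeff_monomialLp, smul_ite, smul_zero,
        Finset.sum_ite_eq']
      split_ifs with h
      · rfl
      · rw [fejerCoeff_of_notMem h, Complex.ofReal_zero, zero_smul, smul_zero]
    simp only [h2] at h1
    refine tendsto_nhds_unique h1 ?_
    have h3 := (Complex.continuous_ofReal.tendsto _).comp (tendsto_fejerCoeff β)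
    simpa using (h3.smul_const (x β)).const_smul (Real.exp (-ε * |logWeight β|) : ℂ)
  refine ⟨g, fun α hα => ?_, hgC, dirichletSeries_ext fun α => ?_⟩
  · rw [hcoeff, hx]
    simp only [hS, ContinuousLinearMap.comp_apply, hT0 α hα, smul_zero]
  · rw [torusToDirichlet_primePow, hcoeff, dirichletTranslate_apply_primePow,
      bohrTransform_primePow]
    rfl

/-- Every series in `ℋ_p⁺` is the Dirichlet series of an operator in `Λ⁺`. -/
lemma TorusDuality.exists_operator (hd : TorusDuality X p q J I) {D : DirichletSeries X}
    (hD : D ∈ hardyPlus X p) {M : ℝ}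
    (hM : ∀ ε : ℝ, 0 < ε → hardyNorm p (dirichletTranslate (ε : ℂ) D) ≤ M) :
    ∃ T : E →L[ℂ] X, (∀ α : ℕ →₀ ℤ, (∃ j, α j < 0) → T (J (torusMonomial (-α))) = 0) ∧
      (∀ α, T (J (torusMonomial (-natIndex α))) = D (primePow α)) ∧ ConeSummingWith M T := by
  set ε : ℕ → ℝ := fun k => 1 / ((k : ℝ) + 1) with hε
  have hε0 (k : ℕ) : 0 < ε k := Nat.one_div_pos_of_nat
  have hεlim : Tendsto ε atTop (𝓝 0) := tendsto_one_div_add_atTop_nhds_zero_nat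
  -- `hardyNorm` is an infimum; the slack `ε k` secures a representative and disappears in the
  -- limit.
  choose f hf hfD hfM using fun k => exists_norm_lt_of_hardyNorm_lt (hD.1 (ε k) (hε0 k))
    ((hM _ (hε0 k)).trans_lt (lt_add_of_pos_right M (hε0 k)))
  set T : ℕ → E →L[ℂ] X := fun k => (torusPairing p q (f k)).comp I with hT
  have hTmono (k : ℕ) (α : ℕ →₀ ℤ) : T k (J (torusMonomial (-α))) = torusFourierCoeff p α (f k) := by
    rw [hT]
    simp only [ContinuousLinearMap.comp_apply]
    rw [hd.comp_eq]
    exact (torusPairing_lpMonomial p q (f k) (-α)).trans (by rw [neg_neg])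
  have hneg (k : ℕ) {α : ℕ →₀ ℤ} (hα : ∃ j, α j < 0) : T k (J (torusMonomial (-α))) = 0 := by
    rw [hTmono, hf k α hα]
  have hpos (α : ℕ →₀ ℕ) :
      Tendsto (fun k => T k (J (torusMonomial (-natIndex α)))) atTop (𝓝 (D (primePow α))) := by
    have h1 (k : ℕ) : T k (J (torusMonomial (-natIndex α))) =
        (Real.exp (-ε k * |logWeight (natIndex α)|) : ℂ) • D (primePow α) := by
      rw [hTmono, ← torusToDirichlet_primePow, hfD, dirichletTranslate_apply_primePow]
    simp only [h1]
    have h2 : Tendsto (fun k => (Real.exp (-ε k * |logWeight (natIndex α)|) : ℂ)) atTop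
        (𝓝 ((Real.exp (-0 * |logWeight (natIndex α)|) : ℝ) : ℂ)) :=
      (Complex.continuous_ofReal.tendsto _).comp
        ((Real.continuous_exp.tendsto _).comp (hεlim.neg.mul_const _))
    simpa using h2.smul_const (D (primePow α))
  obtain ⟨B, hB⟩ : ∃ B : ℝ, ∀ k g, ‖T k g‖ ≤ B * ‖g‖ := by
    have hM0 : 0 ≤ M + 1 := (norm_nonneg _).trans ((hfM 0).le.trans (by simp [hε]))
    refine ⟨M + 1, fun k g => ?_⟩
    have hk : ‖f k‖ ≤ M + 1 := by
      have : ε k ≤ 1 := by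
        exact div_le_one_of_le₀ (by linarith [(Nat.cast_nonneg k : (0 : ℝ) ≤ k)]) (by positivity)
      linarith [hfM k]
    exact (norm_torusPairing_le p q (f k) (I g)).trans
      (mul_le_mul hk (hd.norm_le g) (norm_nonneg _) hM0)
  obtain ⟨Z, hZclosed, hZmem⟩ := exists_isClosed_submodule_cauchySeq T hB
  -- Characters with a negative entry give the zero sequence, the others converge to coefficients of
  -- `D`; uniform boundedness carries convergence to all of `E`.
  have hZ : Z = ⊤ := by
    refine hd.eq_top Z hZclosed fun α => ?_
    rw [hZmem, ← neg_neg α]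
    by_cases hα : ∃ j, (-α) j < 0
    · simp only [hneg _ hα]
      exact cauchySeq_const 0
    · obtain ⟨β, hβ⟩ := exists_natIndex_eq hα
      rw [← hβ]
      exact (hpos β).cauchySeq
  have hlim (g : E) : ∃ y, Tendsto (fun k => T k g) atTop (𝓝 y) := by
    have h1 : g ∈ Z := by rw [hZ]; exact Submodule.mem_top
    exact cauchySeq_tendsto_of_complete ((hZmem g).1 h1)
  choose L hL using hlim
  let T' : E →L[ℂ] X := continuousLinearMapOfTendsto T (tendsto_pi_nhds.2 hL)
  have hT' (g : E) : T' g = L g := rfl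
  refine ⟨T', fun α hα => ?_, fun α => ?_, fun n g hg => ?_⟩
  · rw [hT']
    refine tendsto_nhds_unique (hL _) ?_
    simp only [hneg _ hα]
    exact tendsto_const_nhds
  · rw [hT']
    exact tendsto_nhds_unique (hL _) (hpos α)
  · have h1 : Tendsto (fun k => ∑ i, ‖T k (g i)‖) atTop (𝓝 (∑ i, ‖T' (g i)‖)) :=
      tendsto_finsetSum _ fun i _ => (hL (g i)).norm
    have hsup := norm_sum_le_iSup_dualBall g
    set s := ⨆ ξ : Metric.closedBall (0 : StrongDual ℂ E) 1, ∑ i, ‖ξ.1 (g i)‖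
    have h2 : Tendsto (fun k => (M + ε k) * s) atTop (𝓝 ((M + 0) * s)) :=
      (hεlim.const_add M).mul_const s
    rw [add_zero] at h2
    refine le_of_tendsto_of_tendsto' h1 h2 fun k => ?_
    have h3 := sum_norm_torusPairing_le p q (f k) (fun i => I (g i)) fun i => hd.nonneg _ (hg i)
    rw [← map_sum] at h3
    refine h3.trans (mul_le_mul (hfM k).le ((hd.norm_le _).trans hsup) (norm_nonneg _) ?_)
    exact (norm_nonneg _).trans (hfM k).le

/-- The isometric isomorphism of `Λ⁺(E, X)` and `ℋ_p⁺(X)`. -/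
theorem TorusDuality.exists_linearEquiv (hd : TorusDuality X p q J I) {χ : (ℕ →₀ ℤ) → E}
    (hχ : ∀ α, χ α = J (torusMonomial α)) :
    ∃ Φ : lambdaPlus X χ ≃ₗ[ℂ] hardyPlus X p, ∀ T : lambdaPlus X χ,
      (Φ T : DirichletSeries X) = bohrTransform (operatorSeries χ (T : E →L[ℂ] X)) ∧
        hardyPlusNorm p (Φ T : DirichletSeries X) = coneNorm (T : E →L[ℂ] X) := by
  obtain rfl : χ = fun α => J (torusMonomial α) := funext hχ
  set χ : (ℕ →₀ ℤ) → E := fun α => J (torusMonomial α)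
  have hbound (T : lambdaPlus X χ) {C : ℝ} (hC : 0 < C) (hT : ConeSummingWith C T.1) {ε : ℝ}
      (hε : 0 < ε) : dirichletTranslate (ε : ℂ) (bohrTransform (operatorSeries χ T.1)) ∈
        hardyDirichlet X p ∧
      hardyNorm p (dirichletTranslate (ε : ℂ) (bohrTransform (operatorSeries χ T.1))) ≤ C := by
    obtain ⟨g, hg, hgC, hgD⟩ := hd.exists_hardyTorus T.2.2 hC.le hT hε
    have hgD' : torusToDirichlet p g =
      dirichletTranslate (ε : ℂ) (bohrTransform (operatorSeries χ T.1)) := hgD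
    rw [← hgD']
    exact ⟨⟨g, hg, rfl⟩, (hardyNorm_le hg).trans hgC⟩
  have hmem (T : lambdaPlus X χ) : bohrTransform (operatorSeries χ T.1) ∈ hardyPlus X p := by
    obtain ⟨C, hC, hT⟩ := T.2.1
    exact ⟨fun ε hε => (hbound T hC hT hε).1, C, fun ε hε => (hbound T hC hT hε).2⟩
  let Ψ : lambdaPlus X χ →ₗ[ℂ] hardyPlus X p :=
    { toFun := fun T => ⟨bohrTransform (operatorSeries χ T.1), hmem T⟩
      map_add' := fun _ _ => rfl
      map_smul' := fun _ _ => rfl }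
  have hΨ (T : lambdaPlus X χ) (α : ℕ →₀ ℕ) :
      (Ψ T : DirichletSeries X) (primePow α) = T.1 (J (torusMonomial (-natIndex α))) :=
    bohrTransform_primePow _ _
  -- The kernel of `S - T` is a closed subspace containing every character.
  have hext {S T : E →L[ℂ] X}
      (hS : ∀ α : ℕ →₀ ℤ, (∃ j, α j < 0) → S (J (torusMonomial (-α))) = 0)
      (hT : ∀ α : ℕ →₀ ℤ, (∃ j, α j < 0) → T (J (torusMonomial (-α))) = 0)
      (h : ∀ α, S (J (torusMonomial (-natIndex α))) = T (J (torusMonomial (-natIndex α)))) :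
      S = T := by
    have h1 : LinearMap.ker (S - T).toLinearMap = ⊤ := by
      refine hd.eq_top _ (S - T).isClosed_ker fun α => ?_
      rw [LinearMap.mem_ker, ← neg_neg α]
      change S (J (torusMonomial (-(-α)))) - T (J (torusMonomial (-(-α)))) = 0
      rw [sub_eq_zero]
      by_cases hα : ∃ j, (-α) j < 0
      · rw [hS _ hα, hT _ hα]
      · obtain ⟨β, hβ⟩ := exists_natIndex_eq hα
        rw [← hβ, h]
    ext g
    have h2 : g ∈ LinearMap.ker (S - T).toLinearMap := by rw [h1]; exact Submodule.mem_top
    exact sub_eq_zero.1 h2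
  have hinj : Function.Injective Ψ := fun S T h => by
    refine Subtype.ext (hext S.2.2 T.2.2 fun α => ?_)
    rw [← hΨ, ← hΨ, h]
  have hsurj : Function.Surjective Ψ := fun D => by
    obtain ⟨M, hM⟩ := D.2.2
    obtain ⟨T, hT0, hTD, hTM⟩ := hd.exists_operator D.2
      (M := max M 1) fun ε hε => (hM ε hε).trans (le_max_left _ _)
    refine ⟨⟨T, ⟨max M 1, by positivity, hTM⟩, hT0⟩, Subtype.ext (dirichletSeries_ext fun α => ?_)⟩
    rw [hΨ, hTD]
  refine ⟨LinearEquiv.ofBijective Ψ ⟨hinj, hsurj⟩, fun T => ⟨rfl, ?_⟩⟩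
  change hardyPlusNorm p (Ψ T : DirichletSeries X) = coneNorm T.1
  have : Nonempty {ε : ℝ // 0 < ε} := ⟨⟨1, one_pos⟩⟩
  apply le_antisymm
  · refine le_csInf T.2.1 ?_
    rintro C ⟨hC, hT⟩
    exact ciSup_le fun ε => (hbound T hC hT ε.2).2
  · have hbdd : BddAbove (Set.range fun ε : {ε : ℝ // 0 < ε} =>
        hardyNorm p (dirichletTranslate ((ε : ℝ) : ℂ) (Ψ T : DirichletSeries X))) := by
      obtain ⟨M, hM⟩ := (Ψ T).2.2
      exact ⟨M, by rintro _ ⟨ε, rfl⟩; exact hM ε ε.2⟩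
    have hM (ε : ℝ) (hε : 0 < ε) : hardyNorm p (dirichletTranslate (ε : ℂ)
        (Ψ T : DirichletSeries X)) ≤ hardyPlusNorm p (Ψ T : DirichletSeries X) :=
      le_ciSup hbdd ⟨ε, hε⟩
    have h0 : 0 ≤ hardyPlusNorm p (Ψ T : DirichletSeries X) := by
      refine le_trans (Real.sInf_nonneg ?_) (hM 1 one_pos)
      rintro _ ⟨g, -, -, rfl⟩
      exact norm_nonneg g
    -- `coneNorm` admits only positive constants, so `δ` also covers the case of norm 0. The
    -- operator rebuilt from the series is `T` itself by `hext`, which makes the constant admissible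
    -- for `T`.
    refine le_of_forall_pos_le_add fun δ hδ => ?_
    obtain ⟨T', hT0, hTD, hTM⟩ := hd.exists_operator (Ψ T).2
      (M := hardyPlusNorm p (Ψ T : DirichletSeries X) + δ) fun ε hε => by linarith [hM ε hε]
    have hTT' : T' = T.1 := hext hT0 T.2.2 fun α => by rw [hTD, hΨ]
    rw [hTT'] at hTM
    exact csInf_le ⟨0, fun C hC => hC.1.le⟩ ⟨by linarith, hTM⟩

end BohrTransform

/-! ### The two function spaces: `L_q(𝕋^ℕ)` for `p > 1`, `C(𝕋^ℕ)` for `p = 1` -/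

section Instances

open Filter Topology

lemma toLp_nonneg (q : ℝ≥0∞) [Fact (1 ≤ q)] {f : C(InfTorus, ℂ)} (hf : 0 ≤ f) :
    0 ≤ ContinuousMap.toLp q torusHaar ℂ f := by
  rw [← Lp.coeFn_nonneg]
  filter_upwards [ContinuousMap.coeFn_toLp (𝕜 := ℂ) (p := q) torusHaar f] with ω h
  rw [h]
  exact hf ω

lemma norm_toLp_le_norm_toLp (q : ℝ≥0∞) [Fact (1 ≤ q)] {u v : C(InfTorus, ℂ)}
    (h : ∀ ω, ‖u ω‖ ≤ ‖v ω‖) :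
    ‖ContinuousMap.toLp q torusHaar ℂ u‖ ≤ ‖ContinuousMap.toLp q torusHaar ℂ v‖ := by
  refine Lp.norm_le_norm_of_ae_le ?_
  filter_upwards [ContinuousMap.coeFn_toLp (𝕜 := ℂ) (p := q) torusHaar u,
    ContinuousMap.coeFn_toLp (𝕜 := ℂ) (p := q) torusHaar v] with ω hu hv
  rw [hu, hv]
  exact h ω

lemma norm_toLp_le_norm (q : ℝ≥0∞) [Fact (1 ≤ q)] (f : C(InfTorus, ℂ)) :
    ‖ContinuousMap.toLp q torusHaar ℂ f‖ ≤ ‖f‖ := by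
  have h : ∀ᵐ ω ∂torusHaar, ‖ContinuousMap.toLp q torusHaar ℂ f ω‖ ≤ ‖f‖ := by
    filter_upwards [ContinuousMap.coeFn_toLp (𝕜 := ℂ) (p := q) torusHaar f] with ω hω
    rw [hω]
    exact f.norm_coe_le_norm ω
  simpa [measureUnivNNReal] using Lp.norm_le_of_ae_bound (norm_nonneg f) h

/-- `L_q(𝕋^ℕ)` is in duality with `L_p(𝕋^ℕ, X)` for conjugate exponents and `p > 1`. -/
lemma torusDuality_toLp (p q : ℝ≥0∞) [Fact (1 ≤ p)] [Fact (1 ≤ q)] [ENNReal.HolderConjugate p q]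
    (hp : 1 < p) :
    TorusDuality X p q (ContinuousMap.toLp (E := ℂ) q torusHaar ℂ) (ContinuousLinearMap.id ℂ _) where
  comp_eq _ := rfl
  norm_le _ := le_rfl
  nonneg _ h := h
  map_nonneg _ h := toLp_nonneg q h
  mono _ _ h := norm_toLp_le_norm_toLp q h
  translate_le u f := (norm_toLp_torusTranslate q u f).le
  -- Density of continuous functions needs `q < ∞`, that is `p > 1`; this is why `C(𝕋^ℕ)` replaces
  -- `L_∞` when `p = 1`.
  dense := ContinuousMap.toLp_denseRange ℂ torusHaar ℂ
    ((ENNReal.HolderConjugate.lt_top_iff_one_lt q p).2 hp).ne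
  norm_le_of_duality _ _ hC h := norm_toLp_le_of_duality hp hC h

/-- `C(𝕋^ℕ)` is in duality with `L_1(𝕋^ℕ, X)`. -/
lemma torusDuality_continuousMap :
    TorusDuality X 1 ∞ (ContinuousLinearMap.id ℂ C(InfTorus, ℂ))
      (ContinuousMap.toLp (E := ℂ) ∞ torusHaar ℂ) where
  comp_eq _ := rfl
  norm_le := norm_toLp_le_norm ∞
  nonneg _ h := toLp_nonneg ∞ h
  map_nonneg _ h := h
  mono _ v h := (ContinuousMap.norm_le _ (norm_nonneg _)).2 fun ω =>
    (h ω).trans (v.norm_coe_le_norm ω)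
  translate_le u f := (norm_torusTranslate u f).le
  dense := Function.surjective_id.denseRange
  norm_le_of_duality _ _ hC h := norm_toLp_one_le_of_duality hC h

end Instances

end HardySpaces

theorem mainTheorem2 {X : Type*} [NormedAddCommGroup X] [NormedSpace ℂ X] [CompleteSpace X] :
    (∀ (p q : ℝ≥0∞) [Fact (1 ≤ p)] [Fact (1 ≤ q)], ENNReal.HolderConjugate p q → 1 < p →
      ∃ Φ : lambdaPlus X (lpMonomial q) ≃ₗ[ℂ] hardyPlus X p,
        ∀ T : lambdaPlus X (lpMonomial q),
          (Φ T : DirichletSeries X) =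
              bohrTransform (operatorSeries (lpMonomial q) (T : Lp ℂ q torusHaar →L[ℂ] X)) ∧
            hardyPlusNorm p (Φ T : DirichletSeries X) =
              coneNorm (T : Lp ℂ q torusHaar →L[ℂ] X)) ∧
    (∃ Φ : lambdaPlus X torusMonomial ≃ₗ[ℂ] hardyPlus X 1,
      ∀ T : lambdaPlus X torusMonomial,
        (Φ T : DirichletSeries X) =
            bohrTransform (operatorSeries torusMonomial (T : C(InfTorus, ℂ) →L[ℂ] X)) ∧
          hardyPlusNorm 1 (Φ T : DirichletSeries X) =
            coneNorm (T : C(InfTorus, ℂ) →L[ℂ] X)) := by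
  refine ⟨fun p q _ _ hpq hp => ?_, ?_⟩
  · exact (torusDuality_toLp p q hp).exists_linearEquiv fun _ => rfl
  · have : ENNReal.HolderConjugate 1 ∞ := ENNReal.HolderConjugate.one_top
    exact torusDuality_continuousMap.exists_linearEquiv fun _ => rfl
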